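/- **Model.** Let $Q\ge 1$, $0<\gamma<1/Q$, $\zeta>0$. Let $\Theta_1$ be the set of vectors $\alpha\in\mathbb R^Q$ with $\sum_q\alpha_q=1$ and $\alpha_q\in[\gamma,1-\gamma]$ for every $q$ (A3), and let $\Theta_2$ be the set of matrices $\pi\in[0,1]^{Q\times Q}$ such that - (A1) for all $q\ne q'$ there is $l$ with $\pi_{q,l}\neq\pi_{q',l}$ or $\pi_{l,q}\ne\pi_{l,q'}$; - (A2) for all $q,l$: if $\pi_{q,l}\in(0,1)$ then $\pi_{q,l}\in[\zeta,1-\zeta]$. Let $(\alpha^*,\pi^*)\in\Theta_1\times\Theta_2$, and let $(Z_i)_i$, $(X_{i,j})_{i,j}$ be a directed binary stochastic block model with this parameter: the labels $Z_i\in\{1,\dots,Q\}$ are i.i.d. with $\mathbb P(Z_i=q)=\alpha^*_q$, $X_{i,i}=0$, and given the labels the $X_{i,j}$, $i\ne j$, are independent Bernoulli variables with parameters $\pi^*_{Z_i,Z_j}$. Put $X_{[n]}=(X_{i,j})_{1\le i,j\le n}$ and, with $\log 0=-\infty$, $0\cdot(-\infty)=0$, $e^{-\infty}=0$, $$\mathcal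 L_1(X_{[n]};z,\pi)=\sum_{i\ne j}\{X_{i,j}\log\pi_{z_i,z_j}+(1-X_{i,j})\log(1-\pi_{z_i,z_j})\},$$ $$\mathcal L_2(X_{[n]};\alpha,\pi)=\log\sum_{z\in\{1,\dots,Q\}^n}e^{\mathcal L_1(X_{[n]};z,\pi)}\prod_{i=1}^n\alpha_{z_i},\qquad M_n(\alpha,\pi)=\frac{\mathcal L_2(X_{[n]};\alpha,\pi)}{n(n-1)}.$$ For a $Q\times Q$ matrix $A$ and $\pi\in\Theta_2$ set $$\mathbb M(\pi,A)=\sum_{q,l}\alpha^*_q\alpha^*_l\sum_{q',l'}a_{q,q'}a_{l,l'}\big[\pi^*_{q,l}\log\pi_{q',l'}+(1-\pi^*_{q,l})\log(1-\pi_{q',l'})\big],\qquad \mathbb M(\pi)=\max_{A\in\mathcal A}\mathbb M(\pi,A),$$ where $\mathcal A$ is the set of matrices with nonnegative entries and all row sums equal to $1$. **Theorem 3.2.** 1. For every $\pi\in\Theta_2$ the maximum defining $\mathbb M(\pi)$ (possibly equal to $-\infty$) is attained. 2. Let $d$ be any distance on $\Theta_2$ up to label switching, i.e. $d$ is nonnegative,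 symmetric, satisfies the triangle inequality, is continuous for the usual topology of matrices, and $d(\pi,\pi')=0$ if and only if $\pi'_{q,l}=\pi_{\sigma(q),\sigma(l)}$ for all $q,l$, for some permutation $\sigma$ of $\{1,\dots,Q\}$. Then for every $\eta>0$, $$\sup_{\pi\in\Theta_2,\ d(\pi,\pi^*)\ge\eta}\mathbb M(\pi)<\mathbb M(\pi^*).$$ 3. As $n\to\infty$, $$\sup_{\alpha\in\Theta_1,\ \pi\in\Theta_2}\big|M_n(\alpha,\pi)-\mathbb M(\pi)\big|\longrightarrow 0\quad\text{in probability},$$ where $|M_n(\alpha,\pi)-\mathbb M(\pi)|$ is $0$ if both terms are $-\infty$, and $+\infty$ if exactly one of them is. -/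

import Mathlib

open scoped ENNReal Topology

namespace SBM

noncomputable section

/-! ### Parameters -/

/-- Class proportions `α`: a probability vector with every `α_q` in `[γ, 1 - γ]`. -/
def proportionSet (Q : ℕ) (γ : ℝ) : Set (Fin Q → ℝ) :=
  {α | (∀ q, γ ≤ α q ∧ α q ≤ 1 - γ) ∧ ∑ q, α q = 1}

/-- Connection probability matrices `π`: entries in `[0, 1]`, any two classes are distinguished by
a row or a column, and entries in the open interval `(0, 1)` lie in `[ζ, 1 - ζ]`. -/
def connectionSet (Q : ℕ) (ζ : ℝ) : Set (Matrix (Fin Q) (Fin Q) ℝ) :=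
  {π | (∀ q l, 0 ≤ π q l ∧ π q l ≤ 1) ∧
    (∀ q q', q ≠ q' → ∃ l, π q l ≠ π q' l ∨ π l q ≠ π l q') ∧
    (∀ q l, 0 < π q l → π q l < 1 → ζ ≤ π q l ∧ π q l ≤ 1 - ζ)}

/-- `d` is a distance on the set `S` of connection matrices, where a matrix is identified with the
matrices `(π_{σ(q),σ(l)})` obtained from it by relabelling the classes, and `d` is continuous for
the usual topology of matrices. -/
structure IsDistanceModRelabelling {Q : ℕ} (S : Set (Matrix (Fin Q) (Fin Q) ℝ))
    (d : Matrix (Fin Q) (Fin Q) ℝ → Matrix (Fin Q) (Fin Q) ℝ → ℝ) : Prop where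
  nonneg : ∀ π ∈ S, ∀ π' ∈ S, 0 ≤ d π π'
  eq_zero_iff : ∀ π ∈ S, ∀ π' ∈ S,
    d π π' = 0 ↔ ∃ σ : Equiv.Perm (Fin Q), ∀ q l, π' q l = π (σ q) (σ l)
  symm : ∀ π ∈ S, ∀ π' ∈ S, d π π' = d π' π
  triangle : ∀ π ∈ S, ∀ π' ∈ S, ∀ π'' ∈ S, d π π'' ≤ d π π' + d π' π''
  continuousOn : ContinuousOn (fun p : Matrix (Fin Q) (Fin Q) ℝ × Matrix (Fin Q) (Fin Q) ℝ =>
    d p.1 p.2) (S ×ˢ S)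

/-! ### The model -/

/-- Probability that a Bernoulli variable of parameter `p` takes the value `b`. -/
def bernoulliMass (p : ℝ) (b : Bool) : ℝ := if b then p else 1 - p

/-- `Z` (labels) and `X` (adjacency matrix) follow, under `P`, the directed binary stochastic block
model with parameters `(α, π)` on the vertex set `ℕ`: the labels are i.i.d. with law `α`, there are
no loops, and given the labels the edges `X i j`, `i ≠ j`, are independent, `X i j` being Bernoulli
with parameter `π (Z i) (Z j)`. -/
structure IsSBM {Ω : Type*} [MeasurableSpace Ω] (P : MeasureTheory.Measure Ω) {Q : ℕ}
    (α : Fin Q → ℝ) (π : Matrix (Fin Q) (Fin Q) ℝ)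
    (Z : ℕ → Ω → Fin Q) (X : ℕ → ℕ → Ω → Bool) : Prop where
  measurable_label : ∀ i, Measurable (Z i)
  measurable_edge : ∀ i j, Measurable (X i j)
  no_loop : ∀ i ω, X i i ω = false
  label_law : ∀ (n : ℕ) (z : Fin n → Fin Q),
    P {ω | ∀ i : Fin n, Z i ω = z i} = ENNReal.ofReal (∏ i, α (z i))
  edge_law : ∀ (n : ℕ) (z : Fin n → Fin Q) (x : Fin n → Fin n → Bool),
    P {ω | (∀ i : Fin n, Z i ω = z i) ∧ ∀ i j : Fin n, i ≠ j → X i j ω = x i j} =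
      P {ω | ∀ i : Fin n, Z i ω = z i} *
        ENNReal.ofReal (∏ p ∈ (Finset.univ : Finset (Fin n)).offDiag,
          bernoulliMass (π (z p.1) (z p.2)) (x p.1 p.2))

/-- Adjacency matrix `X_{[n]}` of the first `n` vertices. -/
def adjacency {Ω : Type*} (X : ℕ → ℕ → Ω → Bool) (n : ℕ) (ω : Ω) : Fin n → Fin n → Bool :=
  fun i j => X i j ω

/-! ### Likelihoods, with values in the extended reals -/

/-- Logarithm of a nonnegative real number, with `log 0 = -∞`.
In `EReal`, `0 * (-∞) = 0`. -/
def elog (t : ℝ) : EReal := ENNReal.log (ENNReal.ofReal t)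

/-- Log-likelihood of the observed graph `x` given the labels `z`:
`∑_{i ≠ j} (x_ij log π_{z_i z_j} + (1 - x_ij) log (1 - π_{z_i z_j}))`. -/
def L1 {Q n : ℕ} (x : Fin n → Fin n → Bool) (z : Fin n → Fin Q)
    (π : Matrix (Fin Q) (Fin Q) ℝ) : EReal :=
  ∑ p ∈ (Finset.univ : Finset (Fin n)).offDiag,
    (if x p.1 p.2 then elog (π (z p.1) (z p.2)) else elog (1 - π (z p.1) (z p.2)))

/-- Log-likelihood of the observed graph `x`: `log (∑_z exp (L1 (x; z, π)) ∏_i α_{z_i})`. -/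
def L2 {Q n : ℕ} (x : Fin n → Fin n → Bool) (α : Fin Q → ℝ)
    (π : Matrix (Fin Q) (Fin Q) ℝ) : EReal :=
  ENNReal.log (∑ z : Fin n → Fin Q, EReal.exp (L1 x z π) * ENNReal.ofReal (∏ i, α (z i)))

/-- Normalized log-likelihood `L2 / (n (n - 1))`. -/
def Mn {Q n : ℕ} (x : Fin n → Fin n → Bool) (α : Fin Q → ℝ)
    (π : Matrix (Fin Q) (Fin Q) ℝ) : EReal :=
  L2 x α π / (((n : ℝ) * ((n : ℝ) - 1) : ℝ) : EReal)

/-! ### The limit criterion -/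

/-- `∑_{q,l} α*_q α*_l ∑_{q',l'} a_{qq'} a_{ll'}
  (π*_{ql} log π_{q'l'} + (1 - π*_{ql}) log (1 - π_{q'l'}))`. -/
def limitCriterionAt {Q : ℕ} (αs : Fin Q → ℝ) (πs π A : Matrix (Fin Q) (Fin Q) ℝ) : EReal :=
  ∑ q, ∑ l, ((αs q * αs l : ℝ) : EReal) *
    ∑ q', ∑ l', ((A q q' * A l l' : ℝ) : EReal) *
      ((πs q l : EReal) * elog (π q' l') + ((1 - πs q l : ℝ) : EReal) * elog (1 - π q' l'))

/-- The maximum of `limitCriterionAt αs πs π A` over all row-stochastic matrices `A`, written as a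
supremum. -/
def limitCriterion {Q : ℕ} (αs : Fin Q → ℝ) (πs π : Matrix (Fin Q) (Fin Q) ℝ) : EReal :=
  ⨆ A ∈ Matrix.rowStochastic ℝ (Fin Q), limitCriterionAt αs πs π A

/-- `|x - y|` for extended reals, with `|x - x| = 0` also for infinite `x`. -/
def absDiff (x y : EReal) : ℝ≥0∞ :=
  open scoped Classical in if x = y then 0 else (x - y).abs

/-- `sup_{α, π} |Mn (α, π) - 𝕄(π)|` over the parameter set. -/
def supDeviation {Q n : ℕ} (γ ζ : ℝ) (αs : Fin Q → ℝ) (πs : Matrix (Fin Q) (Fin Q) ℝ)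
    (x : Fin n → Fin n → Bool) : ℝ≥0∞ :=
  ⨆ α ∈ proportionSet Q γ, ⨆ π ∈ connectionSet Q ζ,
    absDiff (Mn x α π) (limitCriterion αs πs π)

end

end SBM

namespace SBM

/-! ### Finite sums of extended reals -/

/-! Put `c = min ζ (1/2)`. Entries of a matrix in `connectionSet` are `0`, `1`, or in `[c, 1 - c]`,
so an infinite logarithm occurs only through an exact `0` or `1`. The closed condition `Admissible`
says that no infinite logarithm carries positive weight: under it the criterion is the continuous
function `realCriterion`, and otherwise it is `⊥`. Attainment follows from compactness of the
row-stochastic matrices.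

Separation. By Gibbs' inequality, applied term by term (`score_lt`), the criterion is at most
`trueValue`. Equality forces `π q' l' = πs q l` wherever `A q q'` and `A l l'` are nonzero. Choosing
a nonzero entry in each row of `A` gives a map of the labels, injective because the classes of `πs`
are distinguishable, hence a permutation. Compactness of `finitePairs` turns this rigidity into a
strict gap away from the relabellings of `πs`.

Uniform convergence. A Chernoff bound makes the edge counts typical for all candidate labellings at
once: the union bound costs `Q ^ n`, against a probability of order `exp (-k n ^ 2)` with `k > 0`.
On a typical sample the rest is deterministic and uniform in `α` and `π`. The log-likelihood differs
from its largest term by at most `n * -log γ`. Every labelling of positive likelihood gives an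
admissible `A` with nearly the same value (`exists_rowStochastic_approx`). Conversely, an admissible
`A` gives such a labelling with nearly at least its value, by drawing labels at random from the rows
of `A` (`exists_labelling_approx`). In particular both quantities are `⊥` simultaneously. -/

lemma EReal_coe_sum {ι : Type*} (s : Finset ι) (f : ι → ℝ) :
    ((∑ i ∈ s, f i : ℝ) : EReal) = ∑ i ∈ s, (f i : EReal) := by
  classical
  induction s using Finset.induction_on with
  | empty => simp
  | insert a s ha ih => rw [Finset.sum_insert ha, Finset.sum_insert ha, EReal.coe_add, ih]

lemma EReal_sum_eq_bot {ι : Type*} {s : Finset ι} {f : ι → EReal} {i : ι} (hi : i ∈ s)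
    (h : f i = ⊥) : ∑ j ∈ s, f j = ⊥ := by
  classical
  rw [← Finset.add_sum_erase s f hi, h, EReal.bot_add]

lemma isClosed_setOf_forall {ι X : Type*} [TopologicalSpace X] {p : ι → X → Prop}
    (h : ∀ i, IsClosed {x | p i x}) : IsClosed {x | ∀ i, p i x} := by
  rw [Set.ofPred_forall]
  exact isClosed_iInter h

lemma isClosed_setOf_or {X : Type*} [TopologicalSpace X] {p q : X → Prop}
    (hp : IsClosed {x | p x}) (hq : IsClosed {x | q x}) : IsClosed {x | p x ∨ q x} :=
  hp.union hq

lemma isClosed_setOf_and {X : Type*} [TopologicalSpace X] {p q : X → Prop}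
    (hp : IsClosed {x | p x}) (hq : IsClosed {x | q x}) : IsClosed {x | p x ∧ q x} :=
  hp.inter hq

/-! ### A real-valued version of the limit criterion -/

/-- Matrices whose entries are `0`, `1`, or lie in `[c, 1 - c]`. -/
def gapSet (Q : ℕ) (c : ℝ) : Set (Matrix (Fin Q) (Fin Q) ℝ) :=
  {π | ∀ q l, π q l = 0 ∨ π q l = 1 ∨ (c ≤ π q l ∧ π q l ≤ 1 - c)}

lemma connectionSet_subset_gapSet {Q : ℕ} {ζ c : ℝ} (hc : c ≤ ζ) :
    connectionSet Q ζ ⊆ gapSet Q c := by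
  intro π hπ q l
  rcases eq_or_lt_of_le (hπ.1 q l).1 with h0 | h0
  · exact Or.inl h0.symm
  rcases eq_or_lt_of_le (hπ.1 q l).2 with h1 | h1
  · exact Or.inr (Or.inl h1)
  · have := hπ.2.2 q l h0 h1
    exact Or.inr (Or.inr ⟨by linarith, by linarith⟩)

/-- The logarithm, truncated below at `c`. -/
noncomputable def truncLog (c t : ℝ) : ℝ := Real.log (max t c)

/-- Expected log-likelihood `p log t + (1 - p) log (1 - t)` of a Bernoulli variable, with
truncated logarithms. -/
noncomputable def score (c p t : ℝ) : ℝ := p * truncLog c t + (1 - p) * truncLog c (1 - t)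

/-- The limit criterion with truncated logarithms. -/
noncomputable def realCriterion (c : ℝ) {Q : ℕ} (αs : Fin Q → ℝ)
    (πs π A : Matrix (Fin Q) (Fin Q) ℝ) : ℝ :=
  ∑ q, ∑ l, αs q * αs l * ∑ q', ∑ l', A q q' * A l l' * score c (πs q l) (π q' l')

/-- The closed condition on `A` under which no logarithm of zero occurs in the limit criterion. -/
def Admissible (c : ℝ) {Q : ℕ} (πs π A : Matrix (Fin Q) (Fin Q) ℝ) : Prop :=
  ∀ q l q' l', A q q' * A l l' = 0 ∨
    ((πs q l = 0 ∨ c ≤ π q' l') ∧ (πs q l = 1 ∨ c ≤ 1 - π q' l'))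

lemma truncLog_of_le {c t : ℝ} (h : c ≤ t) : truncLog c t = Real.log t := by
  rw [truncLog, max_eq_left h]

lemma truncLog_one {c : ℝ} (h : c ≤ 1) : truncLog c 1 = 0 := by
  rw [truncLog_of_le h, Real.log_one]

lemma continuous_truncLog {c : ℝ} (hc : 0 < c) : Continuous (truncLog c) := by
  unfold truncLog
  refine Continuous.log (by fun_prop) fun t => ?_
  exact (lt_of_lt_of_le hc (le_max_right _ _)).ne'

lemma abs_truncLog_le {c t : ℝ} (hc : 0 < c) (hc1 : c ≤ 1) (ht : t ≤ 1) :
    |truncLog c t| ≤ -Real.log c := by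
  have h1 : c ≤ max t c := le_max_right _ _
  have h2 : max t c ≤ 1 := max_le ht hc1
  have h3 : truncLog c t ≤ 0 := Real.log_nonpos (hc.le.trans h1) h2
  have h4 : Real.log c ≤ truncLog c t := Real.log_le_log hc h1
  rw [abs_of_nonpos h3]
  linarith

lemma elog_of_pos {t : ℝ} (ht : 0 < t) : elog t = (Real.log t : EReal) :=
  ENNReal.log_ofReal_of_pos ht

lemma elog_zero : elog 0 = ⊥ := by simp [elog]

/-- A zero weight hides even `log 0`, since `0 * ⊥ = 0`; otherwise the truncation is inactive. -/
lemma coe_mul_elog {c a t : ℝ} (hc : 0 < c) (h : a = 0 ∨ c ≤ t) :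
    (a : EReal) * elog t = ((a * truncLog c t : ℝ) : EReal) := by
  rcases h with h | h
  · simp [h]
  · rw [elog_of_pos (hc.trans_le h), truncLog_of_le h, EReal.coe_mul]

lemma limitCriterionAt_of_admissible {c : ℝ} (hc : 0 < c) {Q : ℕ} {αs : Fin Q → ℝ}
    {πs π A : Matrix (Fin Q) (Fin Q) ℝ} (h : Admissible c πs π A) :
    limitCriterionAt αs πs π A = (realCriterion c αs πs π A : EReal) := by
  unfold limitCriterionAt realCriterion
  rw [EReal_coe_sum]
  refine Finset.sum_congr rfl fun q _ => ?_
  rw [EReal_coe_sum]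
  refine Finset.sum_congr rfl fun l _ => ?_
  rw [EReal.coe_mul (αs q * αs l), EReal_coe_sum]
  congr 1
  refine Finset.sum_congr rfl fun q' _ => ?_
  rw [EReal_coe_sum]
  refine Finset.sum_congr rfl fun l' _ => ?_
  rw [EReal.coe_mul _ (score _ _ _)]
  rcases h q l q' l' with h0 | ⟨h1, h2⟩
  · simp [h0]
  · rw [coe_mul_elog hc h1, coe_mul_elog hc (h2.imp_left fun e => by rw [e, sub_self]),
      ← EReal.coe_add, score]

lemma entry_cases {Q : ℕ} {c : ℝ} {π : Matrix (Fin Q) (Fin Q) ℝ} (hc : c ≤ 1 / 2)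
    (hπ : π ∈ gapSet Q c) (q l : Fin Q) :
    (π q l = 0 ∨ c ≤ π q l) ∧ (π q l = 1 ∨ c ≤ 1 - π q l) := by
  rcases hπ q l with h | h | h
  · exact ⟨Or.inl h, Or.inr (by linarith)⟩
  · exact ⟨Or.inr (by linarith), Or.inl h⟩
  · exact ⟨Or.inr h.1, Or.inr (by linarith)⟩

lemma entry_mem_Icc {Q : ℕ} {c : ℝ} {π : Matrix (Fin Q) (Fin Q) ℝ} (hc : 0 < c)
    (hπ : π ∈ gapSet Q c) (q l : Fin Q) : 0 ≤ π q l ∧ π q l ≤ 1 := by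
  rcases hπ q l with h | h | h
  · exact ⟨h.ge, by linarith⟩
  · exact ⟨by linarith, h.le⟩
  · exact ⟨by linarith, by linarith⟩

/-- A single term `⊥` of positive weight is enough: `⊥` absorbs every summand in `EReal`, and the
weights `αs q * αs l` are positive. -/
lemma limitCriterionAt_of_not_admissible {c : ℝ} (hc : 0 < c) (hc1 : c ≤ 1 / 2) {Q : ℕ}
    {αs : Fin Q → ℝ} (hα : ∀ q, 0 < αs q) {πs π A : Matrix (Fin Q) (Fin Q) ℝ}
    (hπs : πs ∈ gapSet Q c) (hπ : π ∈ gapSet Q c) (hA : ∀ q l, 0 ≤ A q l)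
    (h : ¬ Admissible c πs π A) :
    limitCriterionAt αs πs π A = ⊥ := by
  unfold Admissible at h
  push Not at h
  obtain ⟨q, l, q', l', hA0, h⟩ := h
  have hApos : 0 < A q q' * A l l' := lt_of_le_of_ne (mul_nonneg (hA _ _) (hA _ _)) hA0.symm
  have key : (πs q l : EReal) * elog (π q' l') +
      ((1 - πs q l : ℝ) : EReal) * elog (1 - π q' l') = ⊥ := by
    have hp := entry_mem_Icc hc hπs q l
    by_cases h' : πs q l = 0 ∨ c ≤ π q' l'
    · obtain ⟨h1, h2⟩ := h h'
      have h3 : π q' l' = 1 := ((entry_cases hc1 hπ q' l').2).resolve_right (not_le.2 h2)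
      have h4 : 0 < 1 - πs q l := sub_pos.2 (lt_of_le_of_ne hp.2 h1)
      rw [h3, sub_self, elog_zero, EReal.coe_mul_bot_of_pos h4, EReal.add_bot]
    · push Not at h'
      have h3 : π q' l' = 0 := ((entry_cases hc1 hπ q' l').1).resolve_right (not_le.2 h'.2)
      have h4 : 0 < πs q l := lt_of_le_of_ne hp.1 h'.1.symm
      rw [h3, elog_zero, EReal.coe_mul_bot_of_pos h4, EReal.bot_add]
  refine EReal_sum_eq_bot (Finset.mem_univ q) (EReal_sum_eq_bot (Finset.mem_univ l) ?_)
  have key2 : ∑ q', ∑ l', ((A q q' * A l l' : ℝ) : EReal) *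
      ((πs q l : EReal) * elog (π q' l') +
        ((1 - πs q l : ℝ) : EReal) * elog (1 - π q' l')) = ⊥ :=
    EReal_sum_eq_bot (Finset.mem_univ q') (EReal_sum_eq_bot (Finset.mem_univ l')
      (by rw [key, EReal.coe_mul_bot_of_pos hApos]))
  rw [key2, EReal.coe_mul_bot_of_pos (mul_pos (hα q) (hα l))]

/-! ### Compactness and attainment -/

lemma isCompact_rowStochastic (Q : ℕ) :
    IsCompact (Matrix.rowStochastic ℝ (Fin Q) : Set (Matrix (Fin Q) (Fin Q) ℝ)) := by
  have hK : IsCompact (Set.univ.pi fun _ : Fin Q => Set.univ.pi fun _ : Fin Q =>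
      Set.Icc (0 : ℝ) 1) :=
    isCompact_univ_pi fun _ => isCompact_univ_pi fun _ => isCompact_Icc
  refine IsCompact.of_isClosed_subset hK ?_ ?_
  · have : (Matrix.rowStochastic ℝ (Fin Q) : Set (Matrix (Fin Q) (Fin Q) ℝ)) =
        {M | (∀ i j, 0 ≤ M i j) ∧ ∀ i, ∑ j, M i j = 1} := by
      ext M
      exact Matrix.mem_rowStochastic_iff_sum
    rw [this]
    refine isClosed_setOf_and ?_ ?_
    · exact isClosed_setOf_forall fun i => isClosed_setOf_forall fun j =>
        isClosed_le continuous_const (by fun_prop)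
    · exact isClosed_setOf_forall fun i => isClosed_eq (by fun_prop) continuous_const
  · intro M hM q _ l _
    exact ⟨Matrix.nonneg_of_mem_rowStochastic hM, Matrix.le_one_of_mem_rowStochastic hM⟩

/-- Compactness is the reason for working in `gapSet`: the distinguishability condition of
`connectionSet` is not closed, as two classes may merge in a limit. -/
lemma isCompact_gapSet (Q : ℕ) {c : ℝ} (hc : 0 < c) : IsCompact (gapSet Q c) := by
  have hK : IsCompact (Set.univ.pi fun _ : Fin Q => Set.univ.pi fun _ : Fin Q =>
      Set.Icc (0 : ℝ) 1) :=
    isCompact_univ_pi fun _ => isCompact_univ_pi fun _ => isCompact_Icc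
  refine IsCompact.of_isClosed_subset hK ?_ fun M hM q _ l _ => entry_mem_Icc hc hM q l
  refine isClosed_setOf_forall fun q => isClosed_setOf_forall fun l => ?_
  refine isClosed_setOf_or (isClosed_eq (by fun_prop) continuous_const) ?_
  refine isClosed_setOf_or (isClosed_eq (by fun_prop) continuous_const) ?_
  exact isClosed_setOf_and (isClosed_le continuous_const (by fun_prop))
    (isClosed_le (by fun_prop) continuous_const)

/-- Thanks to the gap, "nonzero entry" is written as `c ≤ π q' l'`, which is a closed condition,
jointly in `π` and `A`. -/
lemma isClosed_admissible {Q : ℕ} (c : ℝ) (πs : Matrix (Fin Q) (Fin Q) ℝ) :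
    IsClosed {p : Matrix (Fin Q) (Fin Q) ℝ × Matrix (Fin Q) (Fin Q) ℝ |
      Admissible c πs p.1 p.2} := by
  refine isClosed_setOf_forall fun q => isClosed_setOf_forall fun l =>
    isClosed_setOf_forall fun q' => isClosed_setOf_forall fun l' => ?_
  refine isClosed_setOf_or (isClosed_eq (by fun_prop) continuous_const) (isClosed_setOf_and ?_ ?_)
  · exact isClosed_setOf_or isClosed_const (isClosed_le continuous_const (by fun_prop))
  · exact isClosed_setOf_or isClosed_const (isClosed_le continuous_const (by fun_prop))

lemma continuous_realCriterion {Q : ℕ} {c : ℝ} (hc : 0 < c) (αs : Fin Q → ℝ)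
    (πs : Matrix (Fin Q) (Fin Q) ℝ) :
    Continuous fun p : Matrix (Fin Q) (Fin Q) ℝ × Matrix (Fin Q) (Fin Q) ℝ =>
      realCriterion c αs πs p.1 p.2 := by
  have h := continuous_truncLog hc
  unfold realCriterion score
  fun_prop

/-- The compact set of pairs `(π, A)` at which the limit criterion is finite. -/
def finitePairs {Q : ℕ} (c : ℝ) (πs : Matrix (Fin Q) (Fin Q) ℝ) :
    Set (Matrix (Fin Q) (Fin Q) ℝ × Matrix (Fin Q) (Fin Q) ℝ) :=
  (gapSet Q c ×ˢ (Matrix.rowStochastic ℝ (Fin Q) : Set (Matrix (Fin Q) (Fin Q) ℝ))) ∩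
    {p | Admissible c πs p.1 p.2}

lemma isCompact_finitePairs {Q : ℕ} {c : ℝ} (hc : 0 < c) (πs : Matrix (Fin Q) (Fin Q) ℝ) :
    IsCompact (finitePairs c πs) :=
  ((isCompact_gapSet Q hc).prod (isCompact_rowStochastic Q)).inter_right (isClosed_admissible c πs)

/-- Either the criterion is infinite at every `A`, or it has a maximum point at which it is
finite. -/
lemma limitCriterion_cases {Q : ℕ} {c : ℝ} (hc : 0 < c) (hc1 : c ≤ 1 / 2) {αs : Fin Q → ℝ}
    (hα : ∀ q, 0 < αs q) {πs π : Matrix (Fin Q) (Fin Q) ℝ} (hπs : πs ∈ gapSet Q c)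
    (hπ : π ∈ gapSet Q c) :
    (limitCriterion αs πs π = ⊥ ∧
      ∀ A ∈ Matrix.rowStochastic ℝ (Fin Q), ¬ Admissible c πs π A) ∨
    ∃ A ∈ Matrix.rowStochastic ℝ (Fin Q), Admissible c πs π A ∧
      limitCriterion αs πs π = (realCriterion c αs πs π A : EReal) ∧
      ∀ B ∈ Matrix.rowStochastic ℝ (Fin Q), Admissible c πs π B →
        realCriterion c αs πs π B ≤ realCriterion c αs πs π A := by
  by_cases hne : ∃ A ∈ Matrix.rowStochastic ℝ (Fin Q), Admissible c πs π A
  · right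
    have hK : IsCompact ((Matrix.rowStochastic ℝ (Fin Q) : Set (Matrix (Fin Q) (Fin Q) ℝ)) ∩
        {A | Admissible c πs π A}) :=
      (isCompact_rowStochastic Q).inter_right
        ((isClosed_admissible c πs).preimage (f := fun A => (π, A)) (by fun_prop))
    have hcont : Continuous fun A => realCriterion c αs πs π A :=
      (continuous_realCriterion hc αs πs).comp (f := fun A => (π, A)) (by fun_prop)
    obtain ⟨A, ⟨hA1, hA2⟩, hmax⟩ := hK.exists_isMaxOn hne hcont.continuousOn
    have hmax' : ∀ B ∈ Matrix.rowStochastic ℝ (Fin Q), Admissible c πs π B →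
        realCriterion c αs πs π B ≤ realCriterion c αs πs π A :=
      fun B hB hB' => hmax ⟨hB, hB'⟩
    refine ⟨A, hA1, hA2, le_antisymm ?_ ?_, hmax'⟩
    · refine iSup₂_le fun B hB => ?_
      by_cases hB' : Admissible c πs π B
      · rw [limitCriterionAt_of_admissible hc hB']
        exact EReal.coe_le_coe_iff.2 (hmax' B hB hB')
      · rw [limitCriterionAt_of_not_admissible hc hc1 hα hπs hπ
          (fun _ _ => Matrix.nonneg_of_mem_rowStochastic hB) hB']
        exact bot_le
    · rw [← limitCriterionAt_of_admissible hc hA2]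
      exact le_iSup₂_of_le A hA1 le_rfl
  · left
    push Not at hne
    refine ⟨?_, hne⟩
    refine le_bot_iff.1 (iSup₂_le fun B hB => ?_)
    rw [limitCriterionAt_of_not_admissible hc hc1 hα hπs hπ
      (fun _ _ => Matrix.nonneg_of_mem_rowStochastic hB) (hne B hB)]

lemma exists_limitCriterionAt_eq {Q : ℕ} {c : ℝ} (hc : 0 < c) (hc1 : c ≤ 1 / 2) {αs : Fin Q → ℝ}
    (hα : ∀ q, 0 < αs q) {πs π : Matrix (Fin Q) (Fin Q) ℝ} (hπs : πs ∈ gapSet Q c)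
    (hπ : π ∈ gapSet Q c) :
    ∃ A ∈ Matrix.rowStochastic ℝ (Fin Q),
      limitCriterionAt αs πs π A = limitCriterion αs πs π := by
  rcases limitCriterion_cases hc hc1 hα hπs hπ with ⟨h, hA⟩ | ⟨A, hA, hA', h, -⟩
  -- The criterion is `⊥` at every `A`, so any row-stochastic matrix attains it.
  · refine ⟨1, one_mem _, ?_⟩
    rw [h, limitCriterionAt_of_not_admissible hc hc1 hα hπs hπ
      (fun _ _ => Matrix.nonneg_of_mem_rowStochastic (one_mem _)) (hA 1 (one_mem _))]
  · exact ⟨A, hA, by rw [h, limitCriterionAt_of_admissible hc hA']⟩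

/-! ### The maximum at the true matrix -/

/-- Gibbs' inequality, from `log u ≤ u - 1` at `t / p` and `(1 - t) / (1 - p)`: weighted by `p` and
`1 - p`, the two linear bounds cancel. Strictness comes from `t / p ≠ 1`. -/
lemma log_score_lt {p t : ℝ} (hp : 0 < p) (hp1 : p < 1) (ht : 0 < t) (ht1 : t < 1) (h : t ≠ p) :
    p * Real.log t + (1 - p) * Real.log (1 - t) <
      p * Real.log p + (1 - p) * Real.log (1 - p) := by
  have hp1' : 0 < 1 - p := by linarith
  have ht1' : 0 < 1 - t := by linarith
  have h1 : Real.log (t / p) < t / p - 1 :=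
    Real.log_lt_sub_one_of_pos (by positivity) (by rw [Ne, div_eq_one_iff_eq hp.ne']; exact h)
  have h2 : Real.log ((1 - t) / (1 - p)) ≤ (1 - t) / (1 - p) - 1 :=
    Real.log_le_sub_one_of_pos (by positivity)
  rw [Real.log_div ht.ne' hp.ne'] at h1
  rw [Real.log_div ht1'.ne' hp1'.ne'] at h2
  have h3 : p * (Real.log t - Real.log p) < p * (t / p - 1) := mul_lt_mul_of_pos_left h1 hp
  have h4 := mul_le_mul_of_nonneg_left h2 hp1'.le
  have h5 : p * (t / p - 1) = t - p := by field_simp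
  have h6 : (1 - p) * ((1 - t) / (1 - p) - 1) = p - t := by field_simp; ring
  linarith

/-- For `p = 0` or `p = 1` a single logarithm remains, negative at `t` and zero at `p`; for the
other `p` no truncation is active and `log_score_lt` applies. -/
lemma score_lt {c p t : ℝ} (hc : 0 < c) (hc1 : c ≤ 1 / 2)
    (hp : p = 0 ∨ p = 1 ∨ (c ≤ p ∧ p ≤ 1 - c)) (ht : 0 ≤ t ∧ t ≤ 1)
    (h : (p = 0 ∨ c ≤ t) ∧ (p = 1 ∨ c ≤ 1 - t)) (hne : t ≠ p) :
    score c p t < score c p p := by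
  have hlt : ∀ s : ℝ, c ≤ s → s < 1 → truncLog c s < 0 := fun s h1 h2 => by
    rw [truncLog_of_le h1]
    exact Real.log_neg (hc.trans_le h1) h2
  rcases hp with rfl | rfl | ⟨hp0, hp1⟩
  · have := hlt (1 - t) (h.2.resolve_left (by norm_num))
      (by linarith [lt_of_le_of_ne ht.1 (Ne.symm hne)])
    simpa [score, truncLog_one (show c ≤ 1 by linarith)] using this
  · have := hlt t (h.1.resolve_left (by norm_num)) (lt_of_le_of_ne ht.2 hne)
    simpa [score, truncLog_one (show c ≤ 1 by linarith)] using this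
  · have h1 := h.1.resolve_left (by linarith)
    have h2 := h.2.resolve_left (by linarith)
    unfold score
    rw [truncLog_of_le h1, truncLog_of_le h2, truncLog_of_le hp0,
      truncLog_of_le (show c ≤ 1 - p by linarith)]
    exact log_score_lt (by linarith) (by linarith) (by linarith) (by linarith) hne

/-- The value of the limit criterion at the true matrix. -/
noncomputable def trueValue (c : ℝ) {Q : ℕ} (αs : Fin Q → ℝ) (πs : Matrix (Fin Q) (Fin Q) ℝ) : ℝ :=
  ∑ q, ∑ l, αs q * αs l * score c (πs q l) (πs q l)

lemma sum_sum_mul_of_rowStochastic {Q : ℕ} {A : Matrix (Fin Q) (Fin Q) ℝ}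
    (hA : A ∈ Matrix.rowStochastic ℝ (Fin Q)) (q l : Fin Q) (s : ℝ) :
    ∑ q', ∑ l', A q q' * A l l' * s = s := by
  simp_rw [← Finset.sum_mul, ← Finset.mul_sum,
    Matrix.sum_row_of_mem_rowStochastic hA, mul_one, Matrix.sum_row_of_mem_rowStochastic hA, one_mul]

/-- Spreading each term over weights of total mass one makes the comparison with `realCriterion`
termwise. -/
lemma trueValue_eq {c : ℝ} {Q : ℕ} (αs : Fin Q → ℝ) (πs : Matrix (Fin Q) (Fin Q) ℝ)
    {A : Matrix (Fin Q) (Fin Q) ℝ} (hA : A ∈ Matrix.rowStochastic ℝ (Fin Q)) :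
    trueValue c αs πs =
      ∑ q, ∑ l, αs q * αs l * ∑ q', ∑ l', A q q' * A l l' * score c (πs q l) (πs q l) := by
  simp_rw [sum_sum_mul_of_rowStochastic hA]
  rfl

lemma realCriterion_term_le {c : ℝ} (hc : 0 < c) (hc1 : c ≤ 1 / 2) {Q : ℕ}
    {πs π A : Matrix (Fin Q) (Fin Q) ℝ} (hπs : πs ∈ gapSet Q c) (h : (π, A) ∈ finitePairs c πs)
    (q l q' l' : Fin Q) :
    A q q' * A l l' * score c (πs q l) (π q' l') ≤
      A q q' * A l l' * score c (πs q l) (πs q l) := by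
  rcases h.2 q l q' l' with h0 | h0
  · simp only at h0
    rw [h0]
    simp
  · refine mul_le_mul_of_nonneg_left ?_ (mul_nonneg (h.1.2.1 _ _) (h.1.2.1 _ _))
    by_cases he : π q' l' = πs q l
    · rw [he]
    · exact (score_lt hc hc1 (hπs q l) (entry_mem_Icc hc h.1.1 q' l') h0 he).le

lemma realCriterion_le_trueValue {c : ℝ} (hc : 0 < c) (hc1 : c ≤ 1 / 2) {Q : ℕ}
    {αs : Fin Q → ℝ} (hα : ∀ q, 0 < αs q)
    {πs π A : Matrix (Fin Q) (Fin Q) ℝ} (hπs : πs ∈ gapSet Q c) (h : (π, A) ∈ finitePairs c πs) :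
    realCriterion c αs πs π A ≤ trueValue c αs πs := by
  rw [trueValue_eq αs πs h.1.2]
  refine Finset.sum_le_sum fun q _ => Finset.sum_le_sum fun l _ =>
    mul_le_mul_of_nonneg_left ?_ (mul_pos (hα q) (hα l)).le
  exact Finset.sum_le_sum fun q' _ => Finset.sum_le_sum fun l' _ =>
    realCriterion_term_le hc hc1 hπs h q l q' l'

/-- One strict Gibbs inequality at a positive weight would make the whole sum strictly smaller. -/
lemma eq_of_realCriterion_eq {c : ℝ} (hc : 0 < c) (hc1 : c ≤ 1 / 2) {Q : ℕ}
    {αs : Fin Q → ℝ} (hα : ∀ q, 0 < αs q)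
    {πs π A : Matrix (Fin Q) (Fin Q) ℝ} (hπs : πs ∈ gapSet Q c) (h : (π, A) ∈ finitePairs c πs)
    (heq : realCriterion c αs πs π A = trueValue c αs πs) (q l q' l' : Fin Q)
    (hq : A q q' ≠ 0) (hl : A l l' ≠ 0) : π q' l' = πs q l := by
  by_contra hne
  refine heq.not_lt ?_
  rw [trueValue_eq αs πs h.1.2]
  have hle := realCriterion_term_le hc hc1 hπs h
  have hle2 : ∀ q l, αs q * αs l * ∑ q', ∑ l', A q q' * A l l' * score c (πs q l) (π q' l') ≤
      αs q * αs l * ∑ q', ∑ l', A q q' * A l l' * score c (πs q l) (πs q l) := fun q l =>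
    mul_le_mul_of_nonneg_left (Finset.sum_le_sum fun q' _ => Finset.sum_le_sum fun l' _ =>
      hle q l q' l') (mul_pos (hα q) (hα l)).le
  refine Finset.sum_lt_sum (fun q _ => Finset.sum_le_sum fun l _ => hle2 q l)
    ⟨q, Finset.mem_univ _, Finset.sum_lt_sum (fun l _ => hle2 q l) ⟨l, Finset.mem_univ _, ?_⟩⟩
  refine mul_lt_mul_of_pos_left ?_ (mul_pos (hα q) (hα l))
  refine Finset.sum_lt_sum (fun q' _ => Finset.sum_le_sum fun l' _ => hle q l q' l')
    ⟨q', Finset.mem_univ _, Finset.sum_lt_sum (fun l' _ => hle q l q' l')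
      ⟨l', Finset.mem_univ _, ?_⟩⟩
  have hpos : 0 < A q q' * A l l' :=
    mul_pos (lt_of_le_of_ne (h.1.2.1 _ _) hq.symm) (lt_of_le_of_ne (h.1.2.1 _ _) hl.symm)
  exact mul_lt_mul_of_pos_left (score_lt hc hc1 (hπs q l) (entry_mem_Icc hc h.1.1 q' l')
    ((h.2 q l q' l').resolve_left hpos.ne') hne) hpos

lemma exists_ne_zero_of_rowStochastic {Q : ℕ} {A : Matrix (Fin Q) (Fin Q) ℝ}
    (hA : A ∈ Matrix.rowStochastic ℝ (Fin Q)) (q : Fin Q) : ∃ q', A q q' ≠ 0 := by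
  by_contra! h
  have := Matrix.sum_row_of_mem_rowStochastic hA q
  simp [h] at this

/-- The criterion reaches its value at the true matrix only at its relabellings. -/
lemma exists_perm_of_realCriterion_eq {c ζ : ℝ} (hc : 0 < c) (hc1 : c ≤ 1 / 2) {Q : ℕ}
    {αs : Fin Q → ℝ} (hα : ∀ q, 0 < αs q)
    {πs π A : Matrix (Fin Q) (Fin Q) ℝ} (hπs : πs ∈ gapSet Q c) (hπs' : πs ∈ connectionSet Q ζ)
    (h : (π, A) ∈ finitePairs c πs)
    (heq : realCriterion c αs πs π A = trueValue c αs πs) :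
    ∃ σ : Equiv.Perm (Fin Q), ∀ q l, πs q l = π (σ q) (σ l) := by
  have key := eq_of_realCriterion_eq hc hc1 hα hπs h heq
  -- `f q` is a column in the support of row `q` of `A`. If `f` merged `q` and `q'`, then `πs` would
  -- have the same rows and columns at `q` and `q'`.
  choose f hf using exists_ne_zero_of_rowStochastic h.1.2
  have hinj : Function.Injective f := by
    intro q q' hqq
    by_contra hne
    obtain ⟨l, hl⟩ := hπs'.2.1 q q' hne
    have e1 := key q l _ _ (hf q) (hf l)
    have e2 := key q' l _ _ (hf q') (hf l)
    have e3 := key l q _ _ (hf l) (hf q)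
    have e4 := key l q' _ _ (hf l) (hf q')
    rw [hqq] at e1 e3
    rcases hl with hl | hl
    · exact hl (e1.symm.trans e2)
    · exact hl (e3.symm.trans e4)
  refine ⟨Equiv.ofBijective f (Finite.injective_iff_bijective.1 hinj), fun q l => ?_⟩
  exact (key q l _ _ (hf q) (hf l)).symm

/-- Needed because a maximiser over a closure is only known to lie in `gapSet`, while `d` is
controlled only on `connectionSet`. -/
lemma connectionSet_of_relabelling {ζ : ℝ} {Q : ℕ} {πs π : Matrix (Fin Q) (Fin Q) ℝ}
    (hπs : πs ∈ connectionSet Q ζ) {σ : Equiv.Perm (Fin Q)}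
    (hσ : ∀ q l, πs q l = π (σ q) (σ l)) : π ∈ connectionSet Q ζ := by
  have hσ' : ∀ q l, π q l = πs (σ.symm q) (σ.symm l) := fun q l => by simp [hσ]
  refine ⟨fun q l => by rw [hσ']; exact hπs.1 _ _, fun q q' hne => ?_, fun q l => ?_⟩
  · obtain ⟨l, hl⟩ := hπs.2.1 (σ.symm q) (σ.symm q') (fun h => hne (σ.symm.injective h))
    exact ⟨σ l, by simpa [hσ'] using hl⟩
  · rw [hσ']
    exact hπs.2.2 _ _

lemma admissible_one {c : ℝ} (hc1 : c ≤ 1 / 2) {Q : ℕ} {πs : Matrix (Fin Q) (Fin Q) ℝ}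
    (hπs : πs ∈ gapSet Q c) : Admissible c πs πs 1 := by
  intro q l q' l'
  by_cases h1 : q = q'
  · by_cases h2 : l = l'
    · subst h1 h2
      exact Or.inr (entry_cases hc1 hπs q l)
    · exact Or.inl (by rw [Matrix.one_apply_ne h2, mul_zero])
  · exact Or.inl (by rw [Matrix.one_apply_ne h1, zero_mul])

lemma realCriterion_one {c : ℝ} {Q : ℕ} (αs : Fin Q → ℝ) (πs : Matrix (Fin Q) (Fin Q) ℝ) :
    realCriterion c αs πs πs 1 = trueValue c αs πs := by
  simp [realCriterion, trueValue, Matrix.one_apply]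

lemma trueValue_le_limitCriterion {c : ℝ} (hc : 0 < c) (hc1 : c ≤ 1 / 2) {Q : ℕ}
    (αs : Fin Q → ℝ) {πs : Matrix (Fin Q) (Fin Q) ℝ} (hπs : πs ∈ gapSet Q c) :
    (trueValue c αs πs : EReal) ≤ limitCriterion αs πs πs := by
  rw [← realCriterion_one αs πs, ← limitCriterionAt_of_admissible hc (admissible_one hc1 hπs)]
  exact le_iSup₂_of_le (1 : Matrix (Fin Q) (Fin Q) ℝ) (one_mem _) le_rfl

lemma iSup_limitCriterion_lt {c ζ : ℝ} (hc : 0 < c) (hc1 : c ≤ 1 / 2) (hcζ : c ≤ ζ) {Q : ℕ}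
    {αs : Fin Q → ℝ} (hα : ∀ q, 0 < αs q) {πs : Matrix (Fin Q) (Fin Q) ℝ}
    (hπs : πs ∈ connectionSet Q ζ)
    {d : Matrix (Fin Q) (Fin Q) ℝ → Matrix (Fin Q) (Fin Q) ℝ → ℝ}
    (hd : IsDistanceModRelabelling (connectionSet Q ζ) d) {η : ℝ} (hη : 0 < η) :
    (⨆ π ∈ {π ∈ connectionSet Q ζ | η ≤ d π πs}, limitCriterion αs πs π) <
      limitCriterion αs πs πs := by
  have hsub := connectionSet_subset_gapSet (Q := Q) hcζ
  have hg := hsub hπs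
  refine lt_of_lt_of_le ?_ (trueValue_le_limitCriterion hc hc1 αs hg)
  set V : Set (Matrix (Fin Q) (Fin Q) ℝ) := {π ∈ connectionSet Q ζ | η ≤ d π πs} with hV
  set W := finitePairs c πs ∩ Prod.fst ⁻¹' V with hW
  have hWc : IsCompact (closure W) :=
    (isCompact_finitePairs hc πs).of_isClosed_subset isClosed_closure
      (closure_minimal Set.inter_subset_left (isCompact_finitePairs hc πs).isClosed)
  have hWsub : closure W ⊆ finitePairs c πs :=
    closure_minimal Set.inter_subset_left (isCompact_finitePairs hc πs).isClosed
  have hcases : ∀ π ∈ V, limitCriterion αs πs π = ⊥ ∨ ∃ A, (π, A) ∈ W ∧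
      limitCriterion αs πs π = (realCriterion c αs πs π A : EReal) := fun π hπ => by
    rcases limitCriterion_cases hc hc1 hα hg (hsub hπ.1) with h | ⟨A, hA, hA', h, -⟩
    · exact Or.inl h.1
    · exact Or.inr ⟨A, ⟨⟨⟨hsub hπ.1, hA⟩, hA'⟩, hπ⟩, h⟩
  rcases (closure W).eq_empty_or_nonempty with hemp | hne
  · refine lt_of_le_of_lt (iSup₂_le fun π hπ => ?_) (EReal.bot_lt_coe _)
    rcases hcases π hπ with h | ⟨A, hA, -⟩
    · exact h.le
    · exact absurd (subset_closure hA) (by rw [hemp]; exact Set.notMem_empty _)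
  · obtain ⟨⟨π₀, A₀⟩, h₀, hmax⟩ :=
      hWc.exists_isMaxOn hne (continuous_realCriterion hc αs πs).continuousOn
    have hlt : realCriterion c αs πs π₀ A₀ < trueValue c αs πs := by
      -- The maximiser `π₀` is only a limit of points of `V`. Equality would make it a relabelling
      -- of `πs`, hence a point of `connectionSet` where `d` is continuous; then `η ≤ d π₀ πs = 0`.
      refine lt_of_le_of_ne (realCriterion_le_trueValue hc hc1 hα hg (hWsub h₀)) fun heq => ?_
      obtain ⟨σ, hσ⟩ := exists_perm_of_realCriterion_eq hc hc1 hα hg hπs (hWsub h₀) heq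
      have hπ₀ := connectionSet_of_relabelling hπs hσ
      have hd0 : d π₀ πs = 0 := (hd.eq_zero_iff _ hπ₀ _ hπs).2 ⟨σ, hσ⟩
      have hcl : π₀ ∈ closure V := by
        have := image_closure_subset_closure_image (s := W) continuous_fst ⟨_, h₀, rfl⟩
        refine closure_mono ?_ this
        rintro _ ⟨p, hp, rfl⟩
        exact hp.2
      have hcont : ContinuousWithinAt (fun π => d π πs) V π₀ := by
        have h1 : ContinuousOn (fun π => d π πs) (connectionSet Q ζ) :=
          hd.continuousOn.comp (f := fun π => (π, πs))
            (continuous_id.prodMk continuous_const).continuousOn fun π hπ => ⟨hπ, hπs⟩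
        exact (h1 π₀ hπ₀).mono fun π hπ => hπ.1
      have := ContinuousWithinAt.closure_le hcl continuousWithinAt_const hcont
        (fun π (hπ : π ∈ V) => hπ.2)
      linarith
    have hmax' : ∀ p ∈ closure W,
        realCriterion c αs πs p.1 p.2 ≤ realCriterion c αs πs π₀ A₀ := fun p hp => hmax hp
    refine lt_of_le_of_lt (iSup₂_le fun π hπ => ?_) (EReal.coe_lt_coe_iff.2 hlt)
    rcases hcases π hπ with h | ⟨A, hA, h⟩
    · rw [h]
      exact bot_le
    · rw [h]
      have := hmax' (π, A) (subset_closure hA)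
      exact EReal.coe_le_coe_iff.2 this

/-! ### Exponential inequality for finite product weights -/

/-- For `|u| ≤ 1`, `exp u ≤ 1 + u + u ^ 2`. The linear term averages to zero, and `1 + lam ^ 2 ≤ exp
(lam ^ 2)`. -/
lemma sum_mul_exp_le {V : Type*} [Fintype V] {w f : V → ℝ} (hw : ∀ v, 0 ≤ w v)
    (hw1 : ∑ v, w v = 1) (hf : ∀ v, |f v| ≤ 1) (hf0 : ∑ v, w v * f v = 0) {lam : ℝ}
    (h0 : 0 ≤ lam) (h1 : lam ≤ 1) :
    ∑ v, w v * Real.exp (lam * f v) ≤ Real.exp (lam ^ 2) := by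
  have hterm : ∀ v, w v * Real.exp (lam * f v) ≤ w v * (1 + lam ^ 2) + lam * (w v * f v) := by
    intro v
    have hle : |lam * f v| ≤ lam := by
      rw [abs_mul, abs_of_nonneg h0]
      exact mul_le_of_le_one_right h0 (hf v)
    have h := (abs_le.1 (Real.abs_exp_sub_one_sub_id_le (hle.trans h1))).2
    have h2 : (lam * f v) ^ 2 ≤ lam ^ 2 := by
      rw [← sq_abs]
      exact pow_le_pow_left₀ (abs_nonneg _) hle 2
    calc w v * Real.exp (lam * f v) ≤ w v * (1 + lam ^ 2 + lam * f v) :=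
          mul_le_mul_of_nonneg_left (by linarith) (hw v)
      _ = _ := by ring
  calc ∑ v, w v * Real.exp (lam * f v)
      ≤ ∑ v, (w v * (1 + lam ^ 2) + lam * (w v * f v)) := Finset.sum_le_sum fun v _ => hterm v
    _ = lam ^ 2 + 1 := by
        rw [Finset.sum_add_distrib, ← Finset.sum_mul, ← Finset.mul_sum, hw1, hf0]
        ring
    _ ≤ Real.exp (lam ^ 2) := Real.add_one_le_exp _

open scoped Classical in
-- Chernoff's method: the indicator of the event is at most `exp (lam * (∑ i, f i (x i) - t))`,
-- whose sum factorises over the coordinates.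
lemma sum_prod_filter_le {ι V : Type*} [Fintype ι] [DecidableEq ι] [Fintype V] {w f : ι → V → ℝ}
    (hw : ∀ i v, 0 ≤ w i v) (hw1 : ∀ i, ∑ v, w i v = 1) (hf : ∀ i v, |f i v| ≤ 1)
    (hf0 : ∀ i, ∑ v, w i v * f i v = 0) {lam : ℝ} (h0 : 0 ≤ lam) (h1 : lam ≤ 1) (t : ℝ) :
    ∑ x : ι → V with t ≤ ∑ i, f i (x i), ∏ i, w i (x i) ≤
      Real.exp (lam ^ 2 * Fintype.card ι - lam * t) := by
  have hpos : ∀ x : ι → V, 0 ≤ ∏ i, w i (x i) := fun x => Finset.prod_nonneg fun i _ => hw _ _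
  calc ∑ x : ι → V with t ≤ ∑ i, f i (x i), ∏ i, w i (x i)
      ≤ ∑ x : ι → V with t ≤ ∑ i, f i (x i),
          (∏ i, w i (x i)) * Real.exp (lam * (∑ i, f i (x i) - t)) := by
        refine Finset.sum_le_sum fun x hx => ?_
        refine le_mul_of_one_le_right (hpos x) (Real.one_le_exp ?_)
        exact mul_nonneg h0 (sub_nonneg.2 (Finset.mem_filter.1 hx).2)
    _ ≤ ∑ x : ι → V, (∏ i, w i (x i)) * Real.exp (lam * (∑ i, f i (x i) - t)) :=
        Finset.sum_le_sum_of_subset_of_nonneg (Finset.filter_subset _ _) fun x _ _ =>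
          mul_nonneg (hpos x) (Real.exp_pos _).le
    _ = ∑ x : ι → V, (∏ i, w i (x i) * Real.exp (lam * f i (x i))) * Real.exp (-(lam * t)) := by
        refine Finset.sum_congr rfl fun x _ => ?_
        rw [Finset.prod_mul_distrib, ← Real.exp_sum, mul_assoc, ← Real.exp_add, ← Finset.mul_sum]
        congr 2
        ring
    _ = (∏ i, ∑ v, w i v * Real.exp (lam * f i v)) * Real.exp (-(lam * t)) := by
        rw [← Finset.sum_mul, Finset.prod_univ_sum, Fintype.piFinset_univ]
    _ ≤ Real.exp (lam ^ 2) ^ Fintype.card ι * Real.exp (-(lam * t)) := by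
        refine mul_le_mul_of_nonneg_right ?_ (Real.exp_pos _).le
        rw [← Finset.card_univ]
        refine (Finset.prod_le_prod (fun i _ => ?_) fun i _ =>
          sum_mul_exp_le (hw i) (hw1 i) (hf i) (hf0 i) h0 h1).trans_eq (by simp)
        exact Finset.sum_nonneg fun v _ => mul_nonneg (hw i v) (Real.exp_pos _).le
    _ = Real.exp (lam ^ 2 * Fintype.card ι - lam * t) := by
        rw [← Real.exp_nat_mul, ← Real.exp_add]
        congr 1
        ring

open scoped Classical in
/-- A two-sided deviation inequality for sums of independent bounded centred variables. -/
lemma sum_prod_filter_abs_le {ι V : Type*} [Fintype ι] [DecidableEq ι] [Fintype V] {w f : ι → V → ℝ}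
    (hw : ∀ i v, 0 ≤ w i v) (hw1 : ∀ i, ∑ v, w i v = 1) (hf : ∀ i v, |f i v| ≤ 1)
    (hf0 : ∀ i, ∑ v, w i v * f i v = 0) {δ : ℝ} (h0 : 0 ≤ δ) (h1 : δ ≤ 1) :
    ∑ x : ι → V with δ * Fintype.card ι ≤ |∑ i, f i (x i)|, ∏ i, w i (x i) ≤
      2 * Real.exp (-(δ ^ 2 / 4 * Fintype.card ι)) := by
  have hpos : ∀ x : ι → V, 0 ≤ ∏ i, w i (x i) := fun x => Finset.prod_nonneg fun i _ => hw _ _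
  -- `lam = δ / 2` minimises `lam ^ 2 - lam * δ`, with value `-δ ^ 2 / 4`.
  have e1 := sum_prod_filter_le hw hw1 hf hf0 (lam := δ / 2) (by linarith) (by linarith)
    (δ * Fintype.card ι)
  have e2 := sum_prod_filter_le (f := fun i v => -f i v) hw hw1 (by simpa using hf)
    (by simpa using hf0) (lam := δ / 2) (by linarith) (by linarith) (δ * Fintype.card ι)
  have e3 : (δ / 2) ^ 2 * (Fintype.card ι : ℝ) - δ / 2 * (δ * Fintype.card ι) =
    -(δ ^ 2 / 4 * Fintype.card ι) := by ring
  rw [e3] at e1 e2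
  calc _ ≤ ∑ x ∈ (Finset.univ.filter fun x : ι → V => δ * Fintype.card ι ≤ ∑ i, f i (x i)) ∪
          (Finset.univ.filter fun x : ι → V => δ * Fintype.card ι ≤ ∑ i, -f i (x i)),
            ∏ i, w i (x i) := by
        refine Finset.sum_le_sum_of_subset_of_nonneg (fun x hx => ?_) fun x _ _ => hpos x
        have := (Finset.mem_filter.1 hx).2
        simpa [Finset.mem_union, le_abs] using this
    _ ≤ _ := by
        have := Finset.sum_union_inter
          (s₁ := Finset.univ.filter fun x : ι → V => δ * Fintype.card ι ≤ ∑ i, f i (x i))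
          (s₂ := Finset.univ.filter fun x : ι → V => δ * Fintype.card ι ≤ ∑ i, -f i (x i))
          (f := fun x => ∏ i, w i (x i))
        have h3 := Finset.sum_nonneg (s := (Finset.univ.filter fun x : ι → V =>
            δ * Fintype.card ι ≤ ∑ i, f i (x i)) ∩
          (Finset.univ.filter fun x : ι → V => δ * Fintype.card ι ≤ ∑ i, -f i (x i)))
          (fun x _ => hpos x)
        linarith

open scoped Classical in
/-- A union bound for finite sums of nonnegative weights. -/
lemma sum_filter_le_sum_sum_filter {κ V : Type*} [Fintype κ] [Fintype V] {W : V → ℝ}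
    (hW : ∀ x, 0 ≤ W x) {p : V → Prop} [DecidablePred p] {q : κ → V → Prop}
    (h : ∀ x, p x → W x ≠ 0 → ∃ k, q k x) :
    ∑ x with p x, W x ≤ ∑ k, ∑ x with q k x, W x := by
  simp_rw [Finset.sum_filter]
  rw [Finset.sum_comm]
  refine Finset.sum_le_sum fun x _ => ?_
  have hnn : ∀ k ∈ Finset.univ, 0 ≤ if q k x then W x else 0 := fun k _ => by
    split_ifs
    exacts [hW x, le_rfl]
  by_cases hx : p x ∧ W x ≠ 0
  · obtain ⟨k, hk⟩ := h x hx.1 hx.2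
    refine le_trans ?_ (Finset.single_le_sum hnn (Finset.mem_univ k))
    rw [if_pos hx.1, if_pos hk]
  · refine le_trans (le_of_eq ?_) (Finset.sum_nonneg hnn)
    rw [ite_eq_right_iff]
    intro hp
    by_contra h0
    exact hx ⟨hp, h0⟩

/-! ### Typical labels and graphs -/

/-- The ordered pairs `i ≠ j` with true labels `(q, l)` and candidate labels `(q', l')`. -/
def cell {Q n : ℕ} (z₀ z : Fin n → Fin Q) (q l q' l' : Fin Q) : Finset (Fin n × Fin n) :=
  (Finset.univ : Finset (Fin n)).offDiag.filter
    fun p => (z₀ p.1 = q ∧ z₀ p.2 = l) ∧ (z p.1 = q' ∧ z p.2 = l')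

/-- The class frequencies are within `δ` of the class probabilities. -/
def TypicalLabels {Q n : ℕ} (δ : ℝ) (αs : Fin Q → ℝ) (z₀ : Fin n → Fin Q) : Prop :=
  ∀ q, |∑ i, ((if z₀ i = q then 1 else 0) - αs q)| < δ * n

/-- No edge event of probability zero occurs, and for every candidate labelling the edge counts
in all cells are close to their conditional means. -/
def TypicalGraph {Q n : ℕ} (δ : ℝ) (πs : Matrix (Fin Q) (Fin Q) ℝ) (z₀ : Fin n → Fin Q)
    (x : Fin n → Fin n → Bool) : Prop :=
  (∀ p ∈ (Finset.univ : Finset (Fin n)).offDiag,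
    bernoulliMass (πs (z₀ p.1) (z₀ p.2)) (x p.1 p.2) ≠ 0) ∧
  ∀ (z : Fin n → Fin Q) (q l q' l' : Fin Q),
    |∑ p ∈ cell z₀ z q l q' l', ((if x p.1 p.2 then 1 else 0) - πs q l)| < δ * n ^ 2

open scoped Classical in
lemma sum_not_typicalLabels_le {Q : ℕ} (n : ℕ) {αs : Fin Q → ℝ} (hα : ∀ q, 0 ≤ αs q)
    (hα1 : ∑ q, αs q = 1) {δ : ℝ} (h0 : 0 ≤ δ) (h1 : δ ≤ 1) :
    ∑ z : Fin n → Fin Q with ¬ TypicalLabels δ αs z, ∏ i, αs (z i) ≤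
      Q * (2 * Real.exp (-(δ ^ 2 / 4 * n))) := by
  have hpos : ∀ z : Fin n → Fin Q, 0 ≤ ∏ i, αs (z i) := fun x =>
    Finset.prod_nonneg fun i _ => hα _
  have hle1 : ∀ q, αs q ≤ 1 := fun q => by
    rw [← hα1]
    exact Finset.single_le_sum (fun q _ => hα q) (Finset.mem_univ q)
  have key : ∀ q : Fin Q, ∑ z : Fin n → Fin Q with
      δ * n ≤ |∑ i, ((if z i = q then 1 else 0) - αs q)|, ∏ i, αs (z i) ≤
        2 * Real.exp (-(δ ^ 2 / 4 * n)) := by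
    intro q
    have := sum_prod_filter_abs_le (ι := Fin n) (V := Fin Q) (w := fun _ v => αs v)
      (f := fun _ v => (if v = q then 1 else 0) - αs q) (fun _ => hα) (fun _ => hα1) ?_ ?_ h0 h1
    · simpa using this
    · intro _ v
      rw [abs_le]
      have := hα q
      have := hle1 q
      split_ifs <;> constructor <;> linarith
    · intro _
      simp [mul_sub, Finset.sum_sub_distrib, ← Finset.sum_mul, hα1]
  have hunion := sum_filter_le_sum_sum_filter (κ := Fin Q) (V := Fin n → Fin Q)
    (p := fun z => ¬ TypicalLabels δ αs z)
    (q := fun q z => δ * n ≤ |∑ i, ((if z i = q then 1 else 0) - αs q)|) hpos ?_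
  · refine hunion.trans ((Finset.sum_le_sum fun q _ => key q).trans (le_of_eq ?_))
    rw [Finset.sum_const, Finset.card_univ, Fintype.card_fin, nsmul_eq_mul]
  · intro z hz _
    unfold TypicalLabels at hz
    push Not at hz
    exact hz

/-- The conditional law of the edge variable at the pair `p`, given the labels. -/
noncomputable def edgeWeight {Q n : ℕ} (πs : Matrix (Fin Q) (Fin Q) ℝ) (z₀ : Fin n → Fin Q)
    (p : Fin n × Fin n) (b : Bool) : ℝ :=
  bernoulliMass (if p.1 = p.2 then 0 else πs (z₀ p.1) (z₀ p.2)) b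

lemma bernoulliMass_nonneg {p : ℝ} (h : 0 ≤ p ∧ p ≤ 1) (b : Bool) : 0 ≤ bernoulliMass p b := by
  cases b <;> simp [bernoulliMass, h.1, h.2]

lemma sum_bernoulliMass (p : ℝ) : ∑ b, bernoulliMass p b = 1 := by
  simp [bernoulliMass]

lemma edgeWeight_nonneg {Q n : ℕ} {πs : Matrix (Fin Q) (Fin Q) ℝ}
    (hπs : ∀ q l, 0 ≤ πs q l ∧ πs q l ≤ 1) (z₀ : Fin n → Fin Q) (p : Fin n × Fin n) (b : Bool) :
    0 ≤ edgeWeight πs z₀ p b := by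
  refine bernoulliMass_nonneg ?_ b
  split_ifs
  · norm_num
  · exact hπs _ _

open scoped Classical in
-- The variables are extended by zero outside the cell, so there are always `n ^ 2` of them and the
-- bound does not depend on the cell size.
lemma sum_cell_deviation_le {Q n : ℕ} {πs : Matrix (Fin Q) (Fin Q) ℝ}
    (hπs : ∀ q l, 0 ≤ πs q l ∧ πs q l ≤ 1) {δ : ℝ} (h0 : 0 ≤ δ) (h1 : δ ≤ 1)
    (z₀ z : Fin n → Fin Q) (q l q' l' : Fin Q) :
    ∑ y : Fin n × Fin n → Bool with
        δ * n ^ 2 ≤ |∑ p ∈ cell z₀ z q l q' l', ((if y p then 1 else 0) - πs q l)|,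
      ∏ p, edgeWeight πs z₀ p (y p) ≤ 2 * Real.exp (-(δ ^ 2 / 4 * n ^ 2)) := by
  have hcard : ((Fintype.card (Fin n × Fin n) : ℕ) : ℝ) = (n : ℝ) ^ 2 := by
    simp [sq]
  have := sum_prod_filter_abs_le (ι := Fin n × Fin n) (V := Bool) (w := edgeWeight πs z₀)
    (f := fun p b => if p ∈ cell z₀ z q l q' l' then (if b then 1 else 0) - πs q l else 0)
    (edgeWeight_nonneg hπs z₀) (fun _ => sum_bernoulliMass _) ?_ ?_ h0 h1
  · rw [hcard] at this
    refine le_trans (le_of_eq ?_) this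
    refine Finset.sum_congr ?_ fun _ _ => rfl
    ext y
    simp only [Finset.mem_filter, Finset.mem_univ, true_and]
    rw [Finset.sum_ite_mem, Finset.univ_inter]
  · intro p b
    have := hπs q l
    split_ifs with hp hb
    · rw [abs_le]; constructor <;> linarith
    · rw [abs_le]; constructor <;> linarith
    · simp
  · intro p
    split_ifs with hp
    · simp only [cell, Finset.mem_filter, Finset.mem_offDiag, Finset.mem_univ, true_and] at hp
      simp only [edgeWeight, if_neg hp.1, hp.2.1.1, hp.2.1.2, Fintype.sum_bool, bernoulliMass]
      simp
      ring
    · simp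

open scoped Classical in
-- Union bound over `Q ^ n` labellings and `Q ^ 4` label quadruples.
lemma sum_not_typicalGraph_le {Q n : ℕ} {πs : Matrix (Fin Q) (Fin Q) ℝ}
    (hπs : ∀ q l, 0 ≤ πs q l ∧ πs q l ≤ 1) {δ : ℝ} (h0 : 0 ≤ δ) (h1 : δ ≤ 1)
    (z₀ : Fin n → Fin Q) :
    ∑ y : Fin n × Fin n → Bool with ¬ TypicalGraph δ πs z₀ (fun i j => y (i, j)),
      ∏ p, edgeWeight πs z₀ p (y p) ≤
        (Q : ℝ) ^ n * Q ^ 4 * (2 * Real.exp (-(δ ^ 2 / 4 * n ^ 2))) := by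
  have hb : ∀ k : (Fin n → Fin Q) × Fin Q × Fin Q × Fin Q × Fin Q,
      ∑ y : Fin n × Fin n → Bool with
        δ * n ^ 2 ≤ |∑ p ∈ cell z₀ k.1 k.2.1 k.2.2.1 k.2.2.2.1 k.2.2.2.2,
          ((if y p then 1 else 0) - πs k.2.1 k.2.2.1)|,
      ∏ p, edgeWeight πs z₀ p (y p) ≤ 2 * Real.exp (-(δ ^ 2 / 4 * n ^ 2)) := fun k =>
    sum_cell_deviation_le hπs h0 h1 z₀ k.1 k.2.1 k.2.2.1 k.2.2.2.1 k.2.2.2.2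
  have hunion := sum_filter_le_sum_sum_filter
    (κ := (Fin n → Fin Q) × Fin Q × Fin Q × Fin Q × Fin Q)
    (V := Fin n × Fin n → Bool) (W := fun y => ∏ p, edgeWeight πs z₀ p (y p))
    (p := fun y => ¬ TypicalGraph δ πs z₀ (fun i j => y (i, j)))
    (q := fun k y => δ * n ^ 2 ≤ |∑ p ∈ cell z₀ k.1 k.2.1 k.2.2.1 k.2.2.2.1 k.2.2.2.2,
      ((if y p then 1 else 0) - πs k.2.1 k.2.2.1)|)
    (fun y => Finset.prod_nonneg fun p _ => edgeWeight_nonneg hπs z₀ p _)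
    ?_
  · refine hunion.trans ((Finset.sum_le_sum fun k _ => hb k).trans (le_of_eq ?_))
    simp only [Finset.sum_const, Finset.card_univ, Fintype.card_prod, Fintype.card_fun,
      Fintype.card_fin, nsmul_eq_mul]
    push_cast
    ring
  · intro y hy hW
    unfold TypicalGraph at hy
    rw [not_and_or] at hy
    rcases hy with hy | hy
    -- An edge event of probability zero makes the weight of `y` vanish, so such `y` need not be
    -- covered.
    · exfalso
      push Not at hy
      obtain ⟨p, hp, hp0⟩ := hy
      refine hW (Finset.prod_eq_zero (Finset.mem_univ p) ?_)
      rw [edgeWeight, if_neg (Finset.mem_offDiag.1 hp).2.2]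
      exact hp0
    · push Not at hy
      obtain ⟨z, q, l, q', l', h⟩ := hy
      exact ⟨(z, q, l, q', l'), h⟩

/-! ### Probability of atypical samples -/

/-- Diagonal pairs have Bernoulli parameter `0`, so they contribute a factor `1` for a loopless
graph. Thus the product weight over the full square reproduces the edge law. -/
lemma prod_edgeWeight {Q n : ℕ} (πs : Matrix (Fin Q) (Fin Q) ℝ) (z₀ : Fin n → Fin Q)
    {y : Fin n × Fin n → Bool} (hy : ∀ i, y (i, i) = false) :
    ∏ p, edgeWeight πs z₀ p (y p) =
      ∏ p ∈ (Finset.univ : Finset (Fin n)).offDiag,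
        bernoulliMass (πs (z₀ p.1) (z₀ p.2)) (y p) := by
  symm
  refine Finset.prod_subset_one_on_sdiff (Finset.subset_univ _) (fun p hp => ?_) fun p hp => ?_
  · have : p.1 = p.2 := by simpa using hp
    obtain ⟨i, j⟩ := p
    simp only at this
    subst this
    simp [edgeWeight, hy, bernoulliMass]
  · rw [edgeWeight, if_neg (Finset.mem_offDiag.1 hp).2.2]

section

variable {Ω : Type*} [MeasurableSpace Ω] {P : MeasureTheory.Measure Ω} {Q : ℕ}
  {αs : Fin Q → ℝ} {πs : Matrix (Fin Q) (Fin Q) ℝ} {Z : ℕ → Ω → Fin Q} {X : ℕ → ℕ → Ω → Bool}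

lemma IsSBM.measure_not_typicalLabels_le (hX : IsSBM P αs πs Z X) (hα : ∀ q, 0 ≤ αs q)
    (hα1 : ∑ q, αs q = 1) {δ : ℝ} (h0 : 0 ≤ δ) (h1 : δ ≤ 1) (n : ℕ) :
    P {ω | ¬ TypicalLabels δ αs (fun i : Fin n => Z i ω)} ≤
      ENNReal.ofReal (Q * (2 * Real.exp (-(δ ^ 2 / 4 * n)))) := by
  classical
  calc P {ω | ¬ TypicalLabels δ αs (fun i : Fin n => Z i ω)}
      ≤ P (⋃ z ∈ Finset.univ.filter fun z : Fin n → Fin Q => ¬ TypicalLabels δ αs z,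
          {ω | ∀ i : Fin n, Z i ω = z i}) := by
        refine MeasureTheory.measure_mono fun ω hω => ?_
        simp only [Set.mem_iUnion]
        exact ⟨fun i => Z i ω, Finset.mem_filter.2 ⟨Finset.mem_univ _, hω⟩, fun i => rfl⟩
    _ ≤ ∑ z : Fin n → Fin Q with ¬ TypicalLabels δ αs z, P {ω | ∀ i : Fin n, Z i ω = z i} :=
        MeasureTheory.measure_biUnion_finset_le _ _
    _ = ENNReal.ofReal (∑ z : Fin n → Fin Q with ¬ TypicalLabels δ αs z, ∏ i, αs (z i)) := by
        rw [ENNReal.ofReal_sum_of_nonneg fun z _ => Finset.prod_nonneg fun i _ => hα _]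
        exact Finset.sum_congr rfl fun z _ => hX.label_law n z
    _ ≤ _ := ENNReal.ofReal_le_ofReal (by
        convert sum_not_typicalLabels_le n hα hα1 h0 h1)

lemma IsSBM.measure_label_inter_not_typicalGraph_le (hX : IsSBM P αs πs Z X)
    (hπs : ∀ q l, 0 ≤ πs q l ∧ πs q l ≤ 1)
    {δ : ℝ} (h0 : 0 ≤ δ) (h1 : δ ≤ 1) (n : ℕ) (z₀ : Fin n → Fin Q) :
    P {ω | (∀ i : Fin n, Z i ω = z₀ i) ∧ ¬ TypicalGraph δ πs z₀ (adjacency X n ω)} ≤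
      P {ω | ∀ i : Fin n, Z i ω = z₀ i} *
        ENNReal.ofReal ((Q : ℝ) ^ n * Q ^ 4 * (2 * Real.exp (-(δ ^ 2 / 4 * n ^ 2)))) := by
  classical
  have hnn : ∀ y : Fin n × Fin n → Bool, 0 ≤ ∏ p, edgeWeight πs z₀ p (y p) := fun y =>
    Finset.prod_nonneg fun p _ => edgeWeight_nonneg hπs z₀ p _
  set T : Finset (Fin n × Fin n → Bool) :=
    Finset.univ.filter fun y => ¬ TypicalGraph δ πs z₀ (fun i j => y (i, j)) with hT
  set S := T.filter fun y => ∀ i, y (i, i) = false with hS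
  calc P {ω | (∀ i : Fin n, Z i ω = z₀ i) ∧ ¬ TypicalGraph δ πs z₀ (adjacency X n ω)}
      ≤ P (⋃ y ∈ S, {ω | (∀ i : Fin n, Z i ω = z₀ i) ∧
          ∀ i j : Fin n, i ≠ j → X i j ω = y (i, j)}) := by
        refine MeasureTheory.measure_mono fun ω hω => ?_
        simp only [Set.mem_iUnion]
        refine ⟨fun p => X p.1 p.2 ω, ?_, hω.1, fun i j _ => rfl⟩
        exact Finset.mem_filter.2 ⟨Finset.mem_filter.2 ⟨Finset.mem_univ _, hω.2⟩,
          fun i => hX.no_loop _ _⟩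
    _ ≤ ∑ y ∈ S, P {ω | (∀ i : Fin n, Z i ω = z₀ i) ∧
          ∀ i j : Fin n, i ≠ j → X i j ω = y (i, j)} :=
        MeasureTheory.measure_biUnion_finset_le _ _
    _ = ∑ y ∈ S, P {ω | ∀ i : Fin n, Z i ω = z₀ i} *
          ENNReal.ofReal (∏ p, edgeWeight πs z₀ p (y p)) := by
        refine Finset.sum_congr rfl fun y hy => ?_
        rw [hX.edge_law n z₀ fun i j => y (i, j),
          prod_edgeWeight πs z₀ (Finset.mem_filter.1 hy).2]
    _ = P {ω | ∀ i : Fin n, Z i ω = z₀ i} *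
          ENNReal.ofReal (∑ y ∈ S, ∏ p, edgeWeight πs z₀ p (y p)) := by
        rw [← Finset.mul_sum, ENNReal.ofReal_sum_of_nonneg fun y _ => hnn y]
    _ ≤ _ := by
        refine mul_le_mul_right (ENNReal.ofReal_le_ofReal ?_) _
        refine (Finset.sum_le_sum_of_subset_of_nonneg (Finset.filter_subset _ _)
          fun y _ _ => hnn y).trans ?_
        convert sum_not_typicalGraph_le hπs h0 h1 z₀

lemma IsSBM.measure_not_typicalGraph_le (hX : IsSBM P αs πs Z X) (hα : ∀ q, 0 ≤ αs q)
    (hα1 : ∑ q, αs q = 1) (hπs : ∀ q l, 0 ≤ πs q l ∧ πs q l ≤ 1)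
    {δ : ℝ} (h0 : 0 ≤ δ) (h1 : δ ≤ 1) (n : ℕ) :
    P {ω | ¬ TypicalGraph δ πs (fun i : Fin n => Z i ω) (adjacency X n ω)} ≤
      ENNReal.ofReal ((Q : ℝ) ^ n * Q ^ 4 * (2 * Real.exp (-(δ ^ 2 / 4 * n ^ 2)))) := by
  set B := ENNReal.ofReal ((Q : ℝ) ^ n * Q ^ 4 * (2 * Real.exp (-(δ ^ 2 / 4 * n ^ 2)))) with hB
  calc P {ω | ¬ TypicalGraph δ πs (fun i : Fin n => Z i ω) (adjacency X n ω)}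
      ≤ P (⋃ z₀ ∈ (Finset.univ : Finset (Fin n → Fin Q)),
          {ω | (∀ i : Fin n, Z i ω = z₀ i) ∧ ¬ TypicalGraph δ πs z₀ (adjacency X n ω)}) := by
        refine MeasureTheory.measure_mono fun ω hω => ?_
        simp only [Set.mem_iUnion]
        exact ⟨fun i => Z i ω, Finset.mem_univ _, fun i => rfl, hω⟩
    _ ≤ ∑ z₀ : Fin n → Fin Q,
          P {ω | (∀ i : Fin n, Z i ω = z₀ i) ∧ ¬ TypicalGraph δ πs z₀ (adjacency X n ω)} :=
        MeasureTheory.measure_biUnion_finset_le _ _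
    _ ≤ ∑ z₀ : Fin n → Fin Q, P {ω | ∀ i : Fin n, Z i ω = z₀ i} * B :=
        Finset.sum_le_sum fun z₀ _ => hX.measure_label_inter_not_typicalGraph_le hπs h0 h1 n z₀
    _ = ENNReal.ofReal (∑ z₀ : Fin n → Fin Q, ∏ i, αs (z₀ i)) * B := by
        rw [← Finset.sum_mul,
          ENNReal.ofReal_sum_of_nonneg fun z _ => Finset.prod_nonneg fun i _ => hα _]
        simp_rw [hX.label_law]
    _ = B := by
        have := Finset.prod_univ_sum (fun _ : Fin n => (Finset.univ : Finset (Fin Q)))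
          (fun _ q => αs q)
        rw [Fintype.piFinset_univ] at this
        rw [← this]
        simp [hα1]

open Filter in
/-- Samples of the block model are typical with probability tending to one. -/
lemma IsSBM.tendsto_measure_not_typical (hX : IsSBM P αs πs Z X) (hα : ∀ q, 0 ≤ αs q)
    (hα1 : ∑ q, αs q = 1) (hπs : ∀ q l, 0 ≤ πs q l ∧ πs q l ≤ 1)
    {δ : ℝ} (h0 : 0 < δ) (h1 : δ ≤ 1) :
    Tendsto (fun n : ℕ => P {ω | ¬ (TypicalLabels δ αs (fun i : Fin n => Z i ω) ∧
      TypicalGraph δ πs (fun i : Fin n => Z i ω) (adjacency X n ω))}) atTop (𝓝 0) := by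
  have hk : 0 < δ ^ 2 / 4 := by positivity
  have t1 : Tendsto (fun n : ℕ => (Q : ℝ) * (2 * Real.exp (-(δ ^ 2 / 4 * n)))) atTop (𝓝 0) := by
    have : Tendsto (fun n : ℕ => Real.exp (-(δ ^ 2 / 4 * n))) atTop (𝓝 0) :=
      Real.tendsto_exp_neg_atTop_nhds_zero.comp
        (tendsto_natCast_atTop_atTop.const_mul_atTop hk)
    simpa using (this.const_mul 2).const_mul (Q : ℝ)
  have t2 : Tendsto (fun n : ℕ => (Q : ℝ) ^ n * Q ^ 4 *
      (2 * Real.exp (-(δ ^ 2 / 4 * n ^ 2)))) atTop (𝓝 0) := by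
    have hexp : Tendsto (fun n : ℕ => (n : ℝ) * (δ ^ 2 / 4 * n - Q)) atTop atTop :=
      tendsto_natCast_atTop_atTop.atTop_mul_atTop₀
        (tendsto_atTop_add_const_right _ _ (tendsto_natCast_atTop_atTop.const_mul_atTop hk))
    have h3 : Tendsto (fun n : ℕ => 2 * (Q : ℝ) ^ 4 *
        Real.exp (-((n : ℝ) * (δ ^ 2 / 4 * n - Q)))) atTop (𝓝 0) := by
      simpa using (Real.tendsto_exp_neg_atTop_nhds_zero.comp hexp).const_mul (2 * (Q : ℝ) ^ 4)
    refine squeeze_zero (fun n => by positivity) (fun n => ?_) h3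
    -- Since `Q ≤ exp Q`, the number of labellings is absorbed in an exponent linear in `n`.
    have h4 : (Q : ℝ) ^ n ≤ Real.exp (n * Q) := by
      rw [Real.exp_nat_mul]
      exact pow_le_pow_left₀ (by positivity) (by linarith [Real.add_one_le_exp (Q : ℝ)]) n
    have h5 : Real.exp (-((n : ℝ) * (δ ^ 2 / 4 * n - Q))) =
        Real.exp (n * Q) * Real.exp (-(δ ^ 2 / 4 * n ^ 2)) := by
      rw [← Real.exp_add]
      congr 1
      ring
    rw [h5]
    have h6 := mul_le_mul_of_nonneg_right h4
      (show 0 ≤ 2 * (Q : ℝ) ^ 4 * Real.exp (-(δ ^ 2 / 4 * n ^ 2)) by positivity)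
    nlinarith
  have t3 := (ENNReal.tendsto_ofReal t1).add (ENNReal.tendsto_ofReal t2)
  rw [ENNReal.ofReal_zero, add_zero] at t3
  refine tendsto_of_tendsto_of_tendsto_of_le_of_le tendsto_const_nhds t3 (fun _ => zero_le)
    fun n => ?_
  refine le_trans ?_ (add_le_add (hX.measure_not_typicalLabels_le hα hα1 h0.le h1 n)
    (hX.measure_not_typicalGraph_le hα hα1 hπs h0.le h1 n))
  refine le_trans (MeasureTheory.measure_mono fun ω hω => ?_) (MeasureTheory.measure_union_le _ _)
  exact not_and_or.1 hω

end

/-! ### Real-valued likelihoods -/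

/-- Conditional likelihood of the graph `x` given the labels `z`. -/
noncomputable def likelihood {Q n : ℕ} (x : Fin n → Fin n → Bool) (z : Fin n → Fin Q)
    (π : Matrix (Fin Q) (Fin Q) ℝ) : ℝ :=
  ∏ p ∈ (Finset.univ : Finset (Fin n)).offDiag, bernoulliMass (π (z p.1) (z p.2)) (x p.1 p.2)

/-- Likelihood of the graph `x`. -/
noncomputable def marginalLikelihood {Q n : ℕ} (x : Fin n → Fin n → Bool) (α : Fin Q → ℝ)
    (π : Matrix (Fin Q) (Fin Q) ℝ) : ℝ :=
  ∑ z : Fin n → Fin Q, likelihood x z π * ∏ i, α (z i)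

/-- Conditional log-likelihood, with truncated logarithms. -/
noncomputable def logLikelihood (c : ℝ) {Q n : ℕ} (x : Fin n → Fin n → Bool) (z : Fin n → Fin Q)
    (π : Matrix (Fin Q) (Fin Q) ℝ) : ℝ :=
  ∑ p ∈ (Finset.univ : Finset (Fin n)).offDiag,
    truncLog c (bernoulliMass (π (z p.1) (z p.2)) (x p.1 p.2))

/-- The bridge from extended to real likelihoods: a term `-∞` becomes a factor zero. -/
lemma exp_sum_elog {ι : Type*} (s : Finset ι) (f : ι → ℝ) (hf : ∀ i ∈ s, 0 ≤ f i) :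
    EReal.exp (∑ i ∈ s, elog (f i)) = ENNReal.ofReal (∏ i ∈ s, f i) := by
  classical
  induction s using Finset.induction_on with
  | empty => simp
  | insert a s ha ih =>
    rw [Finset.sum_insert ha, Finset.prod_insert ha, EReal.exp_add,
      ih fun i hi => hf i (Finset.mem_insert_of_mem hi),
      ENNReal.ofReal_mul (hf a (Finset.mem_insert_self a s)), elog, ENNReal.exp_log]

lemma likelihood_nonneg {Q n : ℕ} (x : Fin n → Fin n → Bool) (z : Fin n → Fin Q)
    {π : Matrix (Fin Q) (Fin Q) ℝ} (hπ : ∀ q l, 0 ≤ π q l ∧ π q l ≤ 1) :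
    0 ≤ likelihood x z π :=
  Finset.prod_nonneg fun _ _ => bernoulliMass_nonneg (hπ _ _) _

lemma exp_L1 {Q n : ℕ} (x : Fin n → Fin n → Bool) (z : Fin n → Fin Q)
    {π : Matrix (Fin Q) (Fin Q) ℝ} (hπ : ∀ q l, 0 ≤ π q l ∧ π q l ≤ 1) :
    EReal.exp (L1 x z π) = ENNReal.ofReal (likelihood x z π) := by
  rw [likelihood, ← exp_sum_elog _ _ fun _ _ => bernoulliMass_nonneg (hπ _ _) _, L1]
  congr 1
  refine Finset.sum_congr rfl fun p _ => ?_
  unfold bernoulliMass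
  split_ifs <;> rfl

lemma L2_eq {Q n : ℕ} (x : Fin n → Fin n → Bool) {α : Fin Q → ℝ} (hα : ∀ q, 0 ≤ α q)
    {π : Matrix (Fin Q) (Fin Q) ℝ} (hπ : ∀ q l, 0 ≤ π q l ∧ π q l ≤ 1) :
    L2 x α π = elog (marginalLikelihood x α π) := by
  have hp : ∀ z : Fin n → Fin Q, 0 ≤ ∏ i, α (z i) := fun z => Finset.prod_nonneg fun _ _ => hα _
  rw [L2, elog, marginalLikelihood, ENNReal.ofReal_sum_of_nonneg fun z _ =>
    mul_nonneg (likelihood_nonneg x z hπ) (hp z)]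
  congr 1
  refine Finset.sum_congr rfl fun z _ => ?_
  rw [exp_L1 x z hπ, ENNReal.ofReal_mul (likelihood_nonneg x z hπ)]

lemma le_bernoulliMass {Q : ℕ} {c : ℝ} (hc1 : c ≤ 1 / 2) {π : Matrix (Fin Q) (Fin Q) ℝ}
    (hπ : π ∈ gapSet Q c) {q l : Fin Q} {b : Bool} (h : bernoulliMass (π q l) b ≠ 0) :
    c ≤ bernoulliMass (π q l) b := by
  have := entry_cases hc1 hπ q l
  cases b
  · simp only [bernoulliMass, Bool.false_eq_true, if_false] at h ⊢
    exact this.2.resolve_left fun e => h (by rw [e, sub_self])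
  · simp only [bernoulliMass, if_true] at h ⊢
    exact this.1.resolve_left h

/-- A nonzero likelihood has no zero factor, and by the gap every factor is then at least `c`: the
truncation is inactive. -/
lemma log_likelihood {Q n : ℕ} {c : ℝ} (hc1 : c ≤ 1 / 2) {π : Matrix (Fin Q) (Fin Q) ℝ}
    (hπ : π ∈ gapSet Q c) {x : Fin n → Fin n → Bool} {z : Fin n → Fin Q}
    (h : likelihood x z π ≠ 0) : Real.log (likelihood x z π) = logLikelihood c x z π := by
  have h' := Finset.prod_ne_zero_iff.1 h
  rw [likelihood, Real.log_prod h', logLikelihood]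
  exact Finset.sum_congr rfl fun p hp => (truncLog_of_le (le_bernoulliMass hc1 hπ (h' p hp))).symm

/-! ### Decomposition into cells -/

/-- A sum over cells of truncated logarithms weighted by coefficients `F` and `G`. -/
noncomputable def weightedScore (c : ℝ) {Q : ℕ} (F G : Fin Q → Fin Q → Fin Q → Fin Q → ℝ)
    (π : Matrix (Fin Q) (Fin Q) ℝ) : ℝ :=
  ∑ q, ∑ l, ∑ q', ∑ l', (F q l q' l' * truncLog c (π q' l') +
    G q l q' l' * truncLog c (1 - π q' l'))

/-- Number of edges in a cell. -/
def edgeCount {Q n : ℕ} (x : Fin n → Fin n → Bool) (z₀ z : Fin n → Fin Q)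
    (q l q' l' : Fin Q) : ℝ :=
  ∑ p ∈ cell z₀ z q l q' l', if x p.1 p.2 then 1 else 0

lemma sum_cell_eq {Q n : ℕ} (z₀ z : Fin n → Fin Q) (g : Fin n × Fin n → ℝ) :
    ∑ q, ∑ l, ∑ q', ∑ l', ∑ p ∈ cell z₀ z q l q' l', g p =
      ∑ p ∈ (Finset.univ : Finset (Fin n)).offDiag, g p := by
  rw [← Finset.sum_fiberwise (Finset.univ : Finset (Fin n)).offDiag
    (fun p => (z₀ p.1, z₀ p.2, z p.1, z p.2)) g]
  simp_rw [Fintype.sum_prod_type, cell, Prod.mk.injEq, and_assoc]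

lemma truncLog_bernoulliMass (c t : ℝ) (b : Bool) :
    truncLog c (bernoulliMass t b) = (if b then 1 else 0) * truncLog c t +
      (1 - if b then 1 else 0) * truncLog c (1 - t) := by
  cases b <;> simp [bernoulliMass]

lemma sum_cell_truncLog {Q n : ℕ} (c t : ℝ) (x : Fin n → Fin n → Bool) (z₀ z : Fin n → Fin Q)
    (q l q' l' : Fin Q) :
    ∑ p ∈ cell z₀ z q l q' l', truncLog c (bernoulliMass t (x p.1 p.2)) =
      edgeCount x z₀ z q l q' l' * truncLog c t +
        ((cell z₀ z q l q' l').card - edgeCount x z₀ z q l q' l') * truncLog c (1 - t) := by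
  simp_rw [truncLog_bernoulliMass, Finset.sum_add_distrib, ← Finset.sum_mul,
    Finset.sum_sub_distrib, edgeCount]
  simp

/-- With `realCriterion_eq`, this writes likelihood and criterion as the same linear form in the
logarithms of `π`, so that only coefficients, free of `π`, remain to be compared. -/
lemma logLikelihood_eq {Q n : ℕ} (c : ℝ) (x : Fin n → Fin n → Bool) (z₀ z : Fin n → Fin Q)
    (π : Matrix (Fin Q) (Fin Q) ℝ) :
    logLikelihood c x z π = weightedScore c (edgeCount x z₀ z)
      (fun q l q' l' => (cell z₀ z q l q' l').card - edgeCount x z₀ z q l q' l') π := by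
  rw [logLikelihood, ← sum_cell_eq z₀ z, weightedScore]
  refine Finset.sum_congr rfl fun q _ => Finset.sum_congr rfl fun l _ =>
    Finset.sum_congr rfl fun q' _ => Finset.sum_congr rfl fun l' _ => ?_
  rw [← sum_cell_truncLog]
  refine Finset.sum_congr rfl fun p hp => ?_
  have h := (Finset.mem_filter.1 hp).2.2
  rw [h.1, h.2]

lemma realCriterion_eq {Q : ℕ} (c : ℝ) (αs : Fin Q → ℝ) (πs π A : Matrix (Fin Q) (Fin Q) ℝ) :
    realCriterion c αs πs π A = weightedScore c
      (fun q l q' l' => (αs q * A q q') * (αs l * A l l') * πs q l)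
      (fun q l q' l' => (αs q * A q q') * (αs l * A l l') * (1 - πs q l)) π := by
  unfold realCriterion weightedScore score
  simp_rw [Finset.mul_sum]
  refine Finset.sum_congr rfl fun q _ => Finset.sum_congr rfl fun l _ =>
    Finset.sum_congr rfl fun q' _ => Finset.sum_congr rfl fun l' _ => ?_
  ring

/-- The truncated logarithms are at most `-log c` in absolute value whatever `π` is; this is the
source of uniformity in `π`. -/
lemma abs_weightedScore_sub_le {Q : ℕ} {c : ℝ} (hc : 0 < c) (hc1 : c ≤ 1)
    {π : Matrix (Fin Q) (Fin Q) ℝ} (hπ : ∀ q l, 0 ≤ π q l ∧ π q l ≤ 1)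
    {F G F' G' : Fin Q → Fin Q → Fin Q → Fin Q → ℝ} {s E : ℝ}
    (hF : ∀ q l q' l', |F q l q' l' / s - F' q l q' l'| ≤ E)
    (hG : ∀ q l q' l', |G q l q' l' / s - G' q l q' l'| ≤ E) :
    |weightedScore c F G π / s - weightedScore c F' G' π| ≤
      2 * (Q : ℝ) ^ 4 * -Real.log c * E := by
  unfold weightedScore
  have hterm : ∀ q l q' l', |(F q l q' l' / s - F' q l q' l') * truncLog c (π q' l') +
      (G q l q' l' / s - G' q l q' l') * truncLog c (1 - π q' l')| ≤ 2 * -Real.log c * E := by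
    intro q l q' l'
    have h1 := abs_truncLog_le hc hc1 (hπ q' l').2
    have h2 := abs_truncLog_le hc hc1 (show 1 - π q' l' ≤ 1 by linarith [(hπ q' l').1])
    have h3 := mul_le_mul (hF q l q' l') h1 (abs_nonneg _) ((abs_nonneg _).trans (hF q l q' l'))
    have h4 := mul_le_mul (hG q l q' l') h2 (abs_nonneg _) ((abs_nonneg _).trans (hG q l q' l'))
    refine (abs_add_le _ _).trans ?_
    rw [abs_mul, abs_mul]
    linarith
  have heq : (∑ q, ∑ l, ∑ q', ∑ l', (F q l q' l' * truncLog c (π q' l') +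
        G q l q' l' * truncLog c (1 - π q' l'))) / s -
      (∑ q, ∑ l, ∑ q', ∑ l', (F' q l q' l' * truncLog c (π q' l') +
        G' q l q' l' * truncLog c (1 - π q' l'))) =
      ∑ q, ∑ l, ∑ q', ∑ l', ((F q l q' l' / s - F' q l q' l') * truncLog c (π q' l') +
        (G q l q' l' / s - G' q l q' l') * truncLog c (1 - π q' l')) := by
    simp_rw [Finset.sum_div, ← Finset.sum_sub_distrib]
    refine Finset.sum_congr rfl fun q _ => Finset.sum_congr rfl fun l _ =>
      Finset.sum_congr rfl fun q' _ => Finset.sum_congr rfl fun l' _ => ?_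
    ring
  rw [heq]
  calc _ ≤ ∑ q : Fin Q, ∑ l : Fin Q, ∑ q' : Fin Q, ∑ l' : Fin Q, 2 * -Real.log c * E := by
        refine (Finset.abs_sum_le_sum_abs _ _).trans (Finset.sum_le_sum fun q _ => ?_)
        refine (Finset.abs_sum_le_sum_abs _ _).trans (Finset.sum_le_sum fun l _ => ?_)
        refine (Finset.abs_sum_le_sum_abs _ _).trans (Finset.sum_le_sum fun q' _ => ?_)
        refine (Finset.abs_sum_le_sum_abs _ _).trans (Finset.sum_le_sum fun l' _ => ?_)
        exact hterm q l q' l'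
    _ = _ := by
        simp only [Finset.sum_const, Finset.card_univ, Fintype.card_fin, nsmul_eq_mul]
        ring

/-! ### Cell sizes and edge counts of typical samples -/

/-- Fraction of the vertices with true label `q` and candidate label `q'`. -/
noncomputable def jointFreq {Q n : ℕ} (z₀ z : Fin n → Fin Q) (q q' : Fin Q) : ℝ :=
  (Finset.univ.filter fun i => z₀ i = q ∧ z i = q').card / n

lemma jointFreq_mem_Icc {Q n : ℕ} (z₀ z : Fin n → Fin Q) (q q' : Fin Q) :
    0 ≤ jointFreq z₀ z q q' ∧ jointFreq z₀ z q q' ≤ 1 := by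
  refine ⟨by unfold jointFreq; positivity, div_le_one_of_le₀ ?_ (by positivity)⟩
  exact_mod_cast (Finset.card_le_univ _).trans_eq (Fintype.card_fin n)

/-- The right-hand side is the plain frequency of the true label `q`, the diagonal case of a joint
frequency. -/
lemma sum_jointFreq {Q n : ℕ} (z₀ z : Fin n → Fin Q) (q : Fin Q) :
    ∑ q', jointFreq z₀ z q q' = jointFreq z₀ z₀ q q := by
  unfold jointFreq
  rw [← Finset.sum_div, ← Nat.cast_sum]
  congr 2
  rw [Finset.card_eq_sum_card_fiberwise (f := z) (t := Finset.univ) (by simp)]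
  refine Finset.sum_congr rfl fun q' _ => ?_
  rw [Finset.filter_filter]
  simp

lemma TypicalLabels.abs_jointFreq_sub_le {Q n : ℕ} {δ : ℝ} {αs : Fin Q → ℝ} {z₀ : Fin n → Fin Q}
    (h : TypicalLabels δ αs z₀) (hn : 0 < n) (q : Fin Q) :
    |jointFreq z₀ z₀ q q - αs q| ≤ δ := by
  have hn' : (0 : ℝ) < n := by exact_mod_cast hn
  have h1 := (h q).le
  have h2 : ∑ i, ((if z₀ i = q then 1 else 0) - αs q) = (jointFreq z₀ z₀ q q - αs q) * n := by
    rw [sub_mul, jointFreq, div_mul_cancel₀ _ hn'.ne']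
    simp [mul_comm]
  rw [h2, abs_mul, abs_of_pos hn'] at h1
  exact le_of_mul_le_mul_right h1 hn'

/-- A cell is a rectangle without its diagonal pairs, of which there are at most `n`. -/
lemma abs_card_cell_sub_le {Q n : ℕ} (z₀ z : Fin n → Fin Q) (q l q' l' : Fin Q) (hn : 0 < n) :
    |((cell z₀ z q l q' l').card : ℝ) / n ^ 2 - jointFreq z₀ z q q' * jointFreq z₀ z l l'| ≤
      1 / n := by
  have hn' : (0 : ℝ) < n := by exact_mod_cast hn
  set A := Finset.univ.filter fun i => z₀ i = q ∧ z i = q' with hA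
  set B := Finset.univ.filter fun i => z₀ i = l ∧ z i = l' with hB
  have h1 : cell z₀ z q l q' l' ⊆ A ×ˢ B := by
    intro p hp
    have := (Finset.mem_filter.1 hp).2
    simp [hA, hB, this]
  have h2 : A ×ˢ B ⊆ cell z₀ z q l q' l' ∪ (Finset.univ : Finset (Fin n)).diag := by
    intro p hp
    simp only [hA, hB, Finset.mem_product, Finset.mem_filter, Finset.mem_univ, true_and] at hp
    by_cases he : p.1 = p.2
    · exact Finset.mem_union_right _ (by simp [he])
    · exact Finset.mem_union_left _ (by simp [cell, he, hp])
  have h3 := Finset.card_le_card h1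
  have h4 := (Finset.card_le_card h2).trans (Finset.card_union_le _ _)
  rw [Finset.card_product] at h3 h4
  rw [Finset.diag_card, Finset.card_univ, Fintype.card_fin] at h4
  have h3' : ((cell z₀ z q l q' l').card : ℝ) ≤ A.card * B.card := by exact_mod_cast h3
  have h4' : (A.card * B.card : ℝ) ≤ (cell z₀ z q l q' l').card + n := by exact_mod_cast h4
  have e : ((cell z₀ z q l q' l').card : ℝ) / n ^ 2 -
      jointFreq z₀ z q q' * jointFreq z₀ z l l' =
      ((cell z₀ z q l q' l').card - A.card * B.card) / n ^ 2 := by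
    rw [jointFreq, jointFreq, ← hA, ← hB]
    field_simp
  rw [e, abs_div, abs_of_pos (show (0 : ℝ) < n ^ 2 by positivity), div_le_div_iff₀ (by positivity)
    hn']
  have : |((cell z₀ z q l q' l').card : ℝ) - A.card * B.card| ≤ n := by
    rw [abs_le]; constructor <;> linarith
  nlinarith

lemma TypicalGraph.abs_edgeCount_sub_le {Q n : ℕ} {δ : ℝ} {πs : Matrix (Fin Q) (Fin Q) ℝ}
    {z₀ : Fin n → Fin Q} {x : Fin n → Fin n → Bool} (h : TypicalGraph δ πs z₀ x)
    (z : Fin n → Fin Q) (q l q' l' : Fin Q) (hn : 0 < n) :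
    |edgeCount x z₀ z q l q' l' / n ^ 2 - πs q l * ((cell z₀ z q l q' l').card / n ^ 2)| < δ := by
  have hn' : (0 : ℝ) < (n : ℝ) ^ 2 := by positivity
  have h1 := h.2 z q l q' l'
  rw [Finset.sum_sub_distrib, Finset.sum_const, nsmul_eq_mul, ← edgeCount] at h1
  rw [← mul_div_assoc, ← sub_div, abs_div, abs_of_pos hn', div_lt_iff₀ hn', mul_comm (πs q l)]
  exact h1

lemma abs_mul_sub_mul_le {a b a' b' E : ℝ} (hb : 0 ≤ b ∧ b ≤ 1) (ha' : 0 ≤ a' ∧ a' ≤ 1)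
    (h1 : |a - a'| ≤ E) (h2 : |b - b'| ≤ E) : |a * b - a' * b'| ≤ 2 * E := by
  have e : a * b - a' * b' = (a - a') * b + a' * (b - b') := by ring
  rw [e]
  refine (abs_add_le _ _).trans ?_
  rw [abs_mul, abs_mul, abs_of_nonneg hb.1, abs_of_nonneg ha'.1]
  have := mul_le_mul h1 hb.2 hb.1 ((abs_nonneg _).trans h1)
  have := mul_le_mul ha'.2 h2 (abs_nonneg _) zero_le_one
  linarith

/-- If the cell size is close to `b * b'`, then the edge and non-edge counts are close to
`b * b' * π` and `b * b' * (1 - π)`. -/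
lemma TypicalGraph.count_approx {Q n : ℕ} {δ : ℝ} {πs : Matrix (Fin Q) (Fin Q) ℝ}
    (hπs : ∀ q l, 0 ≤ πs q l ∧ πs q l ≤ 1)
    {z₀ : Fin n → Fin Q} {x : Fin n → Fin n → Bool} (h : TypicalGraph δ πs z₀ x)
    (z : Fin n → Fin Q) (q l q' l' : Fin Q) (hn : 0 < n) (hnδ : 1 / (n : ℝ) ≤ δ) {b b' E : ℝ}
    (hb : 0 ≤ b ∧ b ≤ 1)
    (h1 : |jointFreq z₀ z q q' - b| ≤ E) (h2 : |jointFreq z₀ z l l' - b'| ≤ E) :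
    |edgeCount x z₀ z q l q' l' / n ^ 2 - b * b' * πs q l| ≤ 2 * δ + 2 * E ∧
    |((cell z₀ z q l q' l').card - edgeCount x z₀ z q l q' l') / n ^ 2 -
      b * b' * (1 - πs q l)| ≤ 2 * δ + 2 * E := by
  have e1 := abs_card_cell_sub_le z₀ z q l q' l' hn
  have e2 := abs_mul_sub_mul_le (jointFreq_mem_Icc z₀ z l l') hb h1 h2
  have e3 := (h.abs_edgeCount_sub_le z q l q' l' hn).le
  set N := ((cell z₀ z q l q' l').card : ℝ) / n ^ 2 with hN
  set S := edgeCount x z₀ z q l q' l' / n ^ 2 with hS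
  have e4 : |N - b * b'| ≤ δ + 2 * E := by
    have := abs_sub_le N (jointFreq z₀ z q q' * jointFreq z₀ z l l') (b * b')
    linarith
  have hp := hπs q l
  constructor
  · have e5 : S - b * b' * πs q l = (S - πs q l * N) + πs q l * (N - b * b') := by ring
    rw [e5]
    refine (abs_add_le _ _).trans ?_
    rw [abs_mul (πs q l), abs_of_nonneg hp.1]
    have := mul_le_of_le_one_left (abs_nonneg (N - b * b')) hp.2
    linarith
  · rw [sub_div, ← hN, ← hS]
    have e5 : N - S - b * b' * (1 - πs q l) =
      -(S - πs q l * N) + (1 - πs q l) * (N - b * b') := by ring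
    rw [e5]
    refine (abs_add_le _ _).trans ?_
    rw [abs_neg, abs_mul (1 - πs q l), abs_of_nonneg (show 0 ≤ 1 - πs q l by linarith)]
    have := mul_le_of_le_one_left (abs_nonneg (N - b * b')) (show 1 - πs q l ≤ 1 by linarith)
    linarith

/-! ### From labellings to row-stochastic matrices -/

/-- Entries below `θ` are dropped and the others renormalised; `ha` keeps the remaining mass
positive. Dropping costs `θ`, renormalising `δ + Q * θ`. The threshold ensures that nonzero entries
of `r` come from well-populated cells, as `TypicalGraph.compatible` requires. -/
lemma exists_row_approx {Q : ℕ} {u : Fin Q → ℝ} (hu : ∀ q, 0 ≤ u q) {a δ θ : ℝ} (hθ : 0 ≤ θ)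
    (hs : |∑ q, u q - a| ≤ δ) (ha : δ + Q * θ < a) :
    ∃ r : Fin Q → ℝ, (∀ q, 0 ≤ r q) ∧ ∑ q, r q = 1 ∧ (∀ q, r q ≠ 0 → θ ≤ u q) ∧
      ∀ q, |u q - a * r q| ≤ δ + (Q + 1) * θ := by
  set v : Fin Q → ℝ := fun q => if θ ≤ u q then u q else 0 with hv
  have hv0 : ∀ q, 0 ≤ v q := fun q => by
    simp only [hv]; split_ifs; exacts [hu q, le_rfl]
  have huv : ∀ q, 0 ≤ u q - v q ∧ u q - v q ≤ θ := fun q => by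
    simp only [hv]
    split_ifs with h
    · simpa using hθ
    · exact ⟨by simpa using hu q, by linarith [not_le.1 h]⟩
  have hsum : 0 ≤ ∑ q, u q - ∑ q, v q ∧ ∑ q, u q - ∑ q, v q ≤ Q * θ := by
    rw [← Finset.sum_sub_distrib]
    refine ⟨Finset.sum_nonneg fun q _ => (huv q).1, ?_⟩
    refine (Finset.sum_le_sum fun q _ => (huv q).2).trans_eq (by simp)
  have hs' := abs_le.1 hs
  set s := ∑ q, v q with hsdef
  have hspos : 0 < s := by linarith
  refine ⟨fun q => v q / s, fun q => div_nonneg (hv0 q) hspos.le, ?_, fun q hq => ?_, fun q => ?_⟩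
  · rw [← Finset.sum_div, ← hsdef, div_self hspos.ne']
  · by_contra h
    exact hq (by simp only [hv, if_neg h, zero_div])
  · have hle : v q / s ≤ 1 := div_le_one_of_le₀
      (Finset.single_le_sum (fun q _ => hv0 q) (Finset.mem_univ q)) hspos.le
    have e : u q - a * (v q / s) = (u q - v q) + (v q / s) * (s - a) := by
      field_simp
      ring
    rw [e]
    refine (abs_add_le _ _).trans ?_
    rw [abs_mul, abs_of_nonneg (huv q).1, abs_of_nonneg (div_nonneg (hv0 q) hspos.le)]
    have h1 : |s - a| ≤ δ + Q * θ := by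
      rw [abs_le]; constructor <;> linarith
    have h2 := mul_le_mul hle h1 (abs_nonneg _) zero_le_one
    linarith [(huv q).2]

/-- The entries of `π` at well-populated cells are compatible with those of the true matrix. -/
lemma TypicalGraph.compatible {Q n : ℕ} {c δ θ : ℝ} (hc1 : c ≤ 1 / 2)
    {πs π : Matrix (Fin Q) (Fin Q) ℝ} (hπs : πs ∈ gapSet Q c) (hπ : π ∈ gapSet Q c)
    (hθ : 0 < θ) (hδθ : 2 * δ ≤ c * θ ^ 2) {z₀ z : Fin n → Fin Q} {x : Fin n → Fin n → Bool}
    (h : TypicalGraph δ πs z₀ x) (hn : 0 < n) (hnδ : 1 / (n : ℝ) ≤ δ)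
    (hlik : likelihood x z π ≠ 0) {q l q' l' : Fin Q} (h1 : θ ≤ jointFreq z₀ z q q')
    (h2 : θ ≤ jointFreq z₀ z l l') :
    (πs q l = 0 ∨ c ≤ π q' l') ∧ (πs q l = 1 ∨ c ≤ 1 - π q' l') := by
  have hn' : (0 : ℝ) < n := by exact_mod_cast hn
  have hδ : 0 < δ := lt_of_lt_of_le (by positivity) hnδ
  have e1 := (abs_le.1 (abs_card_cell_sub_le z₀ z q l q' l' hn)).1
  have e2 := abs_lt.1 (h.abs_edgeCount_sub_le z q l q' l' hn)
  have e3 : θ ^ 2 ≤ jointFreq z₀ z q q' * jointFreq z₀ z l l' := by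
    rw [sq]
    exact mul_le_mul h1 h2 hθ.le (hθ.le.trans h1)
  have hmass := Finset.prod_ne_zero_iff.1 hlik
  have hmem : ∀ p ∈ cell z₀ z q l q' l', bernoulliMass (π q' l') (x p.1 p.2) ≠ 0 := fun p hp => by
    have hp' := Finset.mem_filter.1 hp
    have := hmass p hp'.1
    rwa [hp'.2.2.1, hp'.2.2.2] at this
  set N := ((cell z₀ z q l q' l').card : ℝ) / n ^ 2 with hN
  have hNθ : θ ^ 2 - δ ≤ N := by linarith
  -- The cell holds a fraction at least `θ ^ 2 - δ` of the `n ^ 2` pairs, and `c * (θ ^ 2 - δ) ≥ 2 *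
  -- δ - c * δ ≥ δ`. So an event of probability at least `c` cannot be absent from the cell of a
  -- typical graph.
  have hbig : ∀ t : ℝ, c ≤ t → δ ≤ t * N := fun t ht => by
    have hc0 : 0 < c := by
      by_contra hc0
      have := mul_nonneg (neg_nonneg.2 (not_lt.1 hc0)) (sq_nonneg θ)
      linarith
    have h5 : δ ≤ c * (θ ^ 2 - δ) := by nlinarith
    have h6 : 0 ≤ θ ^ 2 - δ := by nlinarith
    have h7 : c * (θ ^ 2 - δ) ≤ t * N := mul_le_mul ht hNθ h6 (hc0.le.trans ht)
    linarith
  have hs := entry_cases hc1 hπs q l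
  have hp := entry_cases hc1 hπ q' l'
  constructor
  · by_contra hcon
    push Not at hcon
    have h3 := hp.1.resolve_right (not_le.2 hcon.2)
    have h4 := hs.1.resolve_left hcon.1
    -- Where `π` vanishes, positive likelihood forbids edges, although `πs q l ≥ c` predicts some.
    have hS : edgeCount x z₀ z q l q' l' = 0 := by
      refine Finset.sum_eq_zero fun p hp => ?_
      have := hmem p hp
      rw [h3] at this
      by_contra hx
      simp only [ite_eq_right_iff, one_ne_zero, imp_false, not_not] at hx
      exact this (by simp [bernoulliMass, hx])
    rw [hS, zero_div] at e2
    linarith [hbig _ h4]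
  · by_contra hcon
    push Not at hcon
    have h3 := hp.2.resolve_right (not_le.2 hcon.2)
    have h4 := hs.2.resolve_left hcon.1
    have hS : edgeCount x z₀ z q l q' l' = (cell z₀ z q l q' l').card := by
      rw [edgeCount, Finset.card_eq_sum_ones]
      push_cast
      refine Finset.sum_congr rfl fun p hp => ?_
      have := hmem p hp
      rw [h3] at this
      by_contra hx
      have hx' : x p.1 p.2 = false := by simpa using hx
      exact this (by simp [bernoulliMass, hx'])
    rw [hS, ← hN] at e2
    linarith [hbig _ h4]

/-- Row `q` of `A` is essentially the distribution of the candidate label inside the true class `q`,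
so that `αs q * A q q'` approximates `jointFreq z₀ z q q'`. -/
lemma exists_rowStochastic_approx {Q n : ℕ} {c γ δ θ : ℝ} (hc : 0 < c) (hc1 : c ≤ 1 / 2)
    {αs : Fin Q → ℝ} (hα : ∀ q, γ ≤ αs q ∧ αs q ≤ 1)
    {πs π : Matrix (Fin Q) (Fin Q) ℝ} (hπs : πs ∈ gapSet Q c) (hπ : π ∈ gapSet Q c)
    (hθ : 0 < θ) (hδθ : 2 * δ ≤ c * θ ^ 2) (hγ : δ + Q * θ < γ)
    {z₀ z : Fin n → Fin Q} {x : Fin n → Fin n → Bool} (hz₀ : TypicalLabels δ αs z₀)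
    (hx : TypicalGraph δ πs z₀ x) (hn : 0 < n) (hnδ : 1 / (n : ℝ) ≤ δ)
    (hlik : likelihood x z π ≠ 0) :
    ∃ A ∈ Matrix.rowStochastic ℝ (Fin Q), Admissible c πs π A ∧
      |logLikelihood c x z π / n ^ 2 - realCriterion c αs πs π A| ≤
        2 * (Q : ℝ) ^ 4 * -Real.log c * (2 * δ + 2 * (δ + (Q + 1) * θ)) := by
  have hrow : ∀ q, ∃ r : Fin Q → ℝ, (∀ q', 0 ≤ r q') ∧ ∑ q', r q' = 1 ∧
      (∀ q', r q' ≠ 0 → θ ≤ jointFreq z₀ z q q') ∧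
      ∀ q', |jointFreq z₀ z q q' - αs q * r q'| ≤ δ + (Q + 1) * θ := fun q => by
    refine exists_row_approx (fun q' => (jointFreq_mem_Icc z₀ z q q').1) hθ.le ?_
      (hγ.trans_le (hα q).1)
    rw [sum_jointFreq]
    exact hz₀.abs_jointFreq_sub_le hn q
  choose A hA0 hA1 hAθ hAd using hrow
  have hδ : 0 ≤ δ := le_trans (by positivity) hnδ
  have hA : Matrix.of A ∈ Matrix.rowStochastic ℝ (Fin Q) :=
    Matrix.mem_rowStochastic_iff_sum.2 ⟨hA0, hA1⟩
  refine ⟨Matrix.of A, hA, fun q l q' l' => ?_, ?_⟩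
  · by_cases h0 : A q q' * A l l' = 0
    · exact Or.inl h0
    · right
      have h1 := left_ne_zero_of_mul h0
      have h2 := right_ne_zero_of_mul h0
      exact hx.compatible hc1 hπs hπ hθ hδθ hn hnδ hlik (hAθ q q' h1) (hAθ l l' h2)
  · rw [logLikelihood_eq c x z₀, realCriterion_eq]
    have happ := fun q l q' l' => hx.count_approx (entry_mem_Icc hc hπs) z q l q' l' hn hnδ
      (b := αs q * A q q') (b' := αs l * A l l') (E := δ + (Q + 1) * θ) ?_
      (hAd q q') (hAd l l')
    · exact abs_weightedScore_sub_le hc (by linarith) (entry_mem_Icc hc hπ)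
        (fun q l q' l' => (happ q l q' l').1) (fun q l q' l' => (happ q l q' l').2)
    · have h0 : 0 ≤ αs q := le_trans (by nlinarith [(Nat.cast_nonneg Q : (0 : ℝ) ≤ Q)]) (hα q).1
      have h1 : A q q' ≤ 1 := Matrix.le_one_of_mem_rowStochastic hA
      exact ⟨mul_nonneg h0 (hA0 q q'), mul_le_one₀ (hα q).2 (hA0 q q') h1⟩

/-! ### From row-stochastic matrices to labellings -/

/-- The form of the probabilistic method used below; positivity of `W i` will place the chosen
labelling in the support of the random one. -/
lemma exists_pos_le_of_sum_mul {ι : Type*} [Fintype ι] {W F : ι → ℝ} (hW : ∀ i, 0 ≤ W i)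
    (hW1 : ∑ i, W i = 1) : ∃ i, 0 < W i ∧ ∑ j, W j * F j ≤ F i := by
  by_contra! h
  have h1 : ∑ j, W j * F j < ∑ j, W j * ∑ k, W k * F k := by
    obtain ⟨i, -, hi⟩ := Finset.exists_ne_zero_of_sum_ne_zero (by rw [hW1]; exact one_ne_zero)
    have hle : ∀ j, W j * F j ≤ W j * ∑ k, W k * F k := fun j => by
      rcases (hW j).eq_or_lt with h0 | h0
      · rw [← h0]; simp
      · exact mul_le_mul_of_nonneg_left (h j h0).le h0.le
    have hi' := lt_of_le_of_ne (hW i) (Ne.symm hi)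
    exact Finset.sum_lt_sum (fun j _ => hle j)
      ⟨i, Finset.mem_univ _, mul_lt_mul_of_pos_left (h i hi') hi'⟩
  rw [← Finset.sum_mul, hW1, one_mul] at h1
  exact lt_irrefl _ h1

/-- The two-dimensional marginals of a finite product weight. -/
lemma sum_prod_mul_pair {ι V : Type*} [Fintype ι] [DecidableEq ι] [Fintype V]
    {w : ι → V → ℝ} (hw : ∀ i, ∑ v, w i v = 1) (g : V → V → ℝ) {i j : ι} (hij : i ≠ j) :
    ∑ z : ι → V, (∏ k, w k (z k)) * g (z i) (z j) = ∑ a, ∑ b, w i a * w j b * g a b := by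
  classical
  -- Expanding `g` in indicators of the values at `i` and `j` makes each term a product over
  -- coordinates, ready to be summed factor by factor.
  have h1 : ∀ z : ι → V, (∏ k, w k (z k)) * g (z i) (z j) = ∑ a, ∑ b,
      (∏ k, w k (z k) * ((if k = i then if z k = a then 1 else 0 else 1) *
        (if k = j then if z k = b then 1 else 0 else 1))) * g a b := fun z => by
    simp_rw [Finset.prod_mul_distrib, Finset.prod_ite_eq' Finset.univ, Finset.mem_univ, if_true]
    rw [Finset.sum_eq_single (z i), Finset.sum_eq_single (z j)]
    · simp
    · intro b _ hb
      simp [hb.symm]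
    · simp
    · intro a _ ha
      simp [ha.symm]
    · simp
  simp_rw [h1]
  rw [Finset.sum_comm]
  refine Finset.sum_congr rfl fun a _ => ?_
  rw [Finset.sum_comm]
  refine Finset.sum_congr rfl fun b _ => ?_
  rw [← Finset.sum_mul]
  congr 1
  have h2 := Finset.prod_univ_sum (fun _ : ι => (Finset.univ : Finset V)) (fun k v => w k v *
    ((if k = i then if v = a then 1 else 0 else 1) *
        (if k = j then if v = b then 1 else 0 else 1)))
  rw [Fintype.piFinset_univ] at h2
  rw [← h2, Finset.prod_eq_mul i j hij]
  · simp [hij, hij.symm]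
  · intro k _ hk
    simp [hk.1, hk.2, hw]
  · simp
  · simp

lemma cell_self {Q n : ℕ} (z₀ : Fin n → Fin Q) (q l : Fin Q) :
    cell z₀ z₀ q l q l =
      (Finset.univ : Finset (Fin n)).offDiag.filter fun p => (z₀ p.1, z₀ p.2) = (q, l) := by
  simp [cell]

/-- Average of the log-likelihood over independent labels, the label of `i` being drawn from the
row `z₀ i` of `A`. -/
lemma sum_prod_mul_logLikelihood {Q n : ℕ} (c : ℝ) (x : Fin n → Fin n → Bool) (z₀ : Fin n → Fin Q)
    (π : Matrix (Fin Q) (Fin Q) ℝ) {A : Matrix (Fin Q) (Fin Q) ℝ}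
    (hA : A ∈ Matrix.rowStochastic ℝ (Fin Q)) :
    ∑ z : Fin n → Fin Q, (∏ i, A (z₀ i) (z i)) * logLikelihood c x z π =
      weightedScore c (fun q l q' l' => A q q' * A l l' * edgeCount x z₀ z₀ q l q l)
        (fun q l q' l' => A q q' * A l l' *
          ((cell z₀ z₀ q l q l).card - edgeCount x z₀ z₀ q l q l)) π := by
  unfold logLikelihood
  simp_rw [Finset.mul_sum]
  rw [Finset.sum_comm]
  have h1 : ∀ p ∈ (Finset.univ : Finset (Fin n)).offDiag,
      ∑ z : Fin n → Fin Q, (∏ i, A (z₀ i) (z i)) *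
        truncLog c (bernoulliMass (π (z p.1) (z p.2)) (x p.1 p.2)) =
      ∑ a, ∑ b, A (z₀ p.1) a * A (z₀ p.2) b *
        truncLog c (bernoulliMass (π a b) (x p.1 p.2)) := fun p hp =>
    sum_prod_mul_pair (w := fun i => A (z₀ i))
      (fun i => Matrix.sum_row_of_mem_rowStochastic hA _)
      (fun a b => truncLog c (bernoulliMass (π a b) (x p.1 p.2))) (Finset.mem_offDiag.1 hp).2.2
  rw [Finset.sum_congr rfl h1, ← Finset.sum_fiberwise _ (fun p => (z₀ p.1, z₀ p.2)),
    Fintype.sum_prod_type, weightedScore]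
  refine Finset.sum_congr rfl fun q _ => Finset.sum_congr rfl fun l _ => ?_
  rw [← cell_self]
  have h2 : ∀ p ∈ cell z₀ z₀ q l q l, ∑ a, ∑ b, A (z₀ p.1) a * A (z₀ p.2) b *
        truncLog c (bernoulliMass (π a b) (x p.1 p.2)) =
      ∑ a, ∑ b, A q a * A l b * truncLog c (bernoulliMass (π a b) (x p.1 p.2)) := fun p hp => by
    have := (Finset.mem_filter.1 hp).2.1
    rw [this.1, this.2]
  rw [Finset.sum_congr rfl h2, Finset.sum_comm]
  refine Finset.sum_congr rfl fun a _ => ?_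
  rw [Finset.sum_comm]
  refine Finset.sum_congr rfl fun b _ => ?_
  rw [← Finset.mul_sum, sum_cell_truncLog]
  ring

/-- Labels drawn independently, vertex `i` from row `z₀ i` of `A`, have an average log-likelihood
close to `n ^ 2` times the criterion. Some labelling in the support does at least as well; its
likelihood is positive, since `A` is admissible and no impossible edge event occurs in `x`. -/
lemma exists_labelling_approx {Q n : ℕ} {c δ : ℝ} (hc : 0 < c) (hc1 : c ≤ 1 / 2)
    {αs : Fin Q → ℝ} (hα : ∀ q, 0 ≤ αs q ∧ αs q ≤ 1)
    {πs π : Matrix (Fin Q) (Fin Q) ℝ} (hπs : πs ∈ gapSet Q c) (hπ : π ∈ gapSet Q c)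
    {z₀ : Fin n → Fin Q} {x : Fin n → Fin n → Bool} (hz₀ : TypicalLabels δ αs z₀)
    (hx : TypicalGraph δ πs z₀ x) (hn : 0 < n) (hnδ : 1 / (n : ℝ) ≤ δ)
    {A : Matrix (Fin Q) (Fin Q) ℝ} (hA : A ∈ Matrix.rowStochastic ℝ (Fin Q))
    (hadm : Admissible c πs π A) :
    ∃ z : Fin n → Fin Q, 0 < likelihood x z π ∧
      realCriterion c αs πs π A - 2 * (Q : ℝ) ^ 4 * -Real.log c * (4 * δ) ≤
        logLikelihood c x z π / n ^ 2 := by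
  have hn' : (0 : ℝ) < (n : ℝ) ^ 2 := by positivity
  have hA0 : ∀ q l, 0 ≤ A q l := fun q l => Matrix.nonneg_of_mem_rowStochastic hA
  have hA1 : ∀ q l, A q l ≤ 1 := fun q l => Matrix.le_one_of_mem_rowStochastic hA
  have hW1 : ∑ z : Fin n → Fin Q, ∏ i, A (z₀ i) (z i) = 1 := by
    have h2 := Finset.prod_univ_sum (fun _ : Fin n => (Finset.univ : Finset (Fin Q)))
      (fun i v => A (z₀ i) v)
    rw [Fintype.piFinset_univ] at h2
    rw [← h2]
    exact Finset.prod_eq_one fun i _ => Matrix.sum_row_of_mem_rowStochastic hA _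
  obtain ⟨z, hz, hle⟩ := exists_pos_le_of_sum_mul
    (W := fun z : Fin n → Fin Q => ∏ i, A (z₀ i) (z i)) (F := fun z => logLikelihood c x z π)
    (fun z => Finset.prod_nonneg fun i _ => hA0 _ _) hW1
  have hsupp : ∀ i, A (z₀ i) (z i) ≠ 0 := fun i =>
    Finset.prod_ne_zero_iff.1 hz.ne' i (Finset.mem_univ i)
  refine ⟨z, ?_, ?_⟩
  · refine Finset.prod_pos fun p hp => ?_
    have h1 := (hadm (z₀ p.1) (z₀ p.2) (z p.1) (z p.2)).resolve_left
      (mul_ne_zero (hsupp _) (hsupp _))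
    have h2 := hx.1 p hp
    cases hb : x p.1 p.2
    · simp only [bernoulliMass, hb, Bool.false_eq_true, if_false] at h2 ⊢
      have := h1.2.resolve_left fun e => h2 (by rw [e, sub_self])
      linarith
    · simp only [bernoulliMass, hb, if_true] at h2 ⊢
      have := h1.1.resolve_left h2
      linarith
  · rw [sum_prod_mul_logLikelihood c x z₀ π hA] at hle
    have hle' := div_le_div_of_nonneg_right hle hn'.le
    refine le_trans ?_ hle'
    rw [realCriterion_eq]
    have happ := fun q l => hx.count_approx (entry_mem_Icc hc hπs) z₀ q l q l hn hnδ
      (b := αs q) (b' := αs l) (E := δ) (hα q)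
      (hz₀.abs_jointFreq_sub_le hn q) (hz₀.abs_jointFreq_sub_le hn l)
    have hmul : ∀ q l q' l' (S T : ℝ), |S / n ^ 2 - αs q * αs l * T| ≤ 2 * δ + 2 * δ →
        |A q q' * A l l' * S / n ^ 2 - αs q * A q q' * (αs l * A l l') * T| ≤ 4 * δ := by
      intro q l q' l' S T h
      have e : A q q' * A l l' * S / n ^ 2 - αs q * A q q' * (αs l * A l l') * T =
        (A q q' * A l l') * (S / n ^ 2 - αs q * αs l * T) := by ring
      rw [e, abs_mul, abs_of_nonneg (mul_nonneg (hA0 _ _) (hA0 _ _))]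
      refine (mul_le_of_le_one_left (abs_nonneg _) ?_).trans (by linarith)
      exact mul_le_one₀ (hA1 _ _) (hA0 _ _) (hA1 _ _)
    have := abs_weightedScore_sub_le hc (by linarith) (entry_mem_Icc hc hπ)
      (fun q l q' l' => hmul q l q' l' _ _ (happ q l).1)
      (fun q l q' l' => hmul q l q' l' _ _ (happ q l).2)
    linarith [(abs_le.1 this).1]

/-! ### Comparison of the likelihood with its largest term -/

lemma sum_prod_proportions {Q : ℕ} (n : ℕ) {α : Fin Q → ℝ} (hα1 : ∑ q, α q = 1) :
    ∑ z : Fin n → Fin Q, ∏ i, α (z i) = 1 := by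
  have h2 := Finset.prod_univ_sum (fun _ : Fin n => (Finset.univ : Finset (Fin Q)))
    (fun _ v => α v)
  rw [Fintype.piFinset_univ] at h2
  rw [← h2]
  exact Finset.prod_eq_one fun i _ => hα1

lemma exists_marginalLikelihood_le {Q n : ℕ} (x : Fin n → Fin n → Bool) {α : Fin Q → ℝ}
    (hα : ∀ q, 0 ≤ α q) (hα1 : ∑ q, α q = 1) {π : Matrix (Fin Q) (Fin Q) ℝ}
    (h : 0 < marginalLikelihood x α π) :
    ∃ z, marginalLikelihood x α π ≤ likelihood x z π := by
  -- There is no labelling when `Q = 0 < n`; positivity of the sum excludes this.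
  have hne : (Finset.univ : Finset (Fin n → Fin Q)).Nonempty := by
    by_contra he
    rw [Finset.not_nonempty_iff_eq_empty] at he
    rw [marginalLikelihood, he, Finset.sum_empty] at h
    exact lt_irrefl _ h
  obtain ⟨z, -, hz⟩ := Finset.exists_max_image Finset.univ (fun z => likelihood x z π) hne
  refine ⟨z, ?_⟩
  calc marginalLikelihood x α π ≤ ∑ z' : Fin n → Fin Q, likelihood x z π * ∏ i, α (z' i) :=
        Finset.sum_le_sum fun z' _ => mul_le_mul_of_nonneg_right (hz z' (Finset.mem_univ _))
          (Finset.prod_nonneg fun i _ => hα _)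
    _ = likelihood x z π := by rw [← Finset.mul_sum, sum_prod_proportions n hα1, mul_one]

/-- Keeping one term of the sum costs a factor `γ ^ n`, which is negligible at the scale `n ^ 2` of
the logarithm. -/
lemma likelihood_mul_pow_le {Q n : ℕ} (x : Fin n → Fin n → Bool) {α : Fin Q → ℝ} {γ : ℝ}
    (hγ : 0 ≤ γ) (hα : ∀ q, γ ≤ α q) {π : Matrix (Fin Q) (Fin Q) ℝ}
    (hπ : ∀ q l, 0 ≤ π q l ∧ π q l ≤ 1) (z : Fin n → Fin Q) :
    likelihood x z π * γ ^ n ≤ marginalLikelihood x α π := by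
  have h1 : γ ^ n ≤ ∏ i, α (z i) := by
    calc γ ^ n = ∏ _i : Fin n, γ := by simp
      _ ≤ _ := Finset.prod_le_prod (fun _ _ => hγ) fun i _ => hα _
  refine (mul_le_mul_of_nonneg_left h1 (likelihood_nonneg x z hπ)).trans ?_
  exact Finset.single_le_sum (f := fun z => likelihood x z π * ∏ i, α (z i))
    (fun z _ => mul_nonneg (likelihood_nonneg x z hπ)
      (Finset.prod_nonneg fun i _ => hγ.trans (hα _))) (Finset.mem_univ z)

lemma abs_logLikelihood_le {Q n : ℕ} {c : ℝ} (hc : 0 < c) (hc1 : c ≤ 1) (x : Fin n → Fin n → Bool)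
    (z : Fin n → Fin Q) {π : Matrix (Fin Q) (Fin Q) ℝ} (hπ : ∀ q l, 0 ≤ π q l ∧ π q l ≤ 1) :
    |logLikelihood c x z π| ≤ -Real.log c * n ^ 2 := by
  have hK : 0 ≤ -Real.log c := neg_nonneg.2 (Real.log_nonpos hc.le hc1)
  have hmass : ∀ p : Fin n × Fin n, bernoulliMass (π (z p.1) (z p.2)) (x p.1 p.2) ≤ 1 :=
    fun p => by
    have := hπ (z p.1) (z p.2)
    unfold bernoulliMass
    split_ifs <;> linarith
  calc |logLikelihood c x z π| ≤ ∑ p ∈ (Finset.univ : Finset (Fin n)).offDiag, -Real.log c :=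
        (Finset.abs_sum_le_sum_abs _ _).trans
          (Finset.sum_le_sum fun p _ => abs_truncLog_le hc hc1 (hmass p))
    _ ≤ ∑ p : Fin n × Fin n, -Real.log c :=
        Finset.sum_le_sum_of_subset_of_nonneg (Finset.subset_univ _) fun _ _ _ => hK
    _ = _ := by
        rw [Finset.sum_const, Finset.card_univ, Fintype.card_prod, Fintype.card_fin, nsmul_eq_mul]
        push_cast
        ring

lemma log_marginalLikelihood_ge {Q n : ℕ} {c γ : ℝ} (hc1 : c ≤ 1 / 2)
    (x : Fin n → Fin n → Bool) {α : Fin Q → ℝ}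
    (hγ : 0 < γ) (hα : ∀ q, γ ≤ α q) {π : Matrix (Fin Q) (Fin Q) ℝ} (hπ : π ∈ gapSet Q c)
    (hπ' : ∀ q l, 0 ≤ π q l ∧ π q l ≤ 1) {z : Fin n → Fin Q} (hz : 0 < likelihood x z π) :
    0 < marginalLikelihood x α π ∧
    logLikelihood c x z π - n * -Real.log γ ≤ Real.log (marginalLikelihood x α π) := by
  have h1 := likelihood_mul_pow_le x hγ.le hα hπ' z
  have h2 : 0 < likelihood x z π * γ ^ n := by positivity
  refine ⟨h2.trans_le h1, ?_⟩
  have h3 := Real.log_le_log h2 h1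
  rw [Real.log_mul hz.ne' (by positivity), Real.log_pow, log_likelihood hc1 hπ hz.ne'] at h3
  linarith

/-! ### Uniform convergence -/

lemma absDiff_coe_le {a b e : ℝ} (h : |a - b| ≤ e) :
    absDiff (a : EReal) (b : EReal) ≤ ENNReal.ofReal e := by
  unfold absDiff
  split_ifs
  · exact zero_le
  · rw [← EReal.coe_sub, EReal.abs_def]
    exact ENNReal.ofReal_le_ofReal h

/-- Cells are measured against `n ^ 2`, while `Mn` divides by `n * (n - 1)`. -/
lemma abs_div_mul_pred_sub_le {t C n : ℝ} (hn : 1 < n) (h : |t| ≤ C * n ^ 2) :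
    |t / (n * (n - 1)) - t / n ^ 2| ≤ C / (n - 1) := by
  have h1 : 0 < n - 1 := by linarith
  have e : t / (n * (n - 1)) - t / n ^ 2 = t / (n ^ 2 * (n - 1)) := by
    field_simp
    ring
  rw [e, abs_div, abs_of_pos (by positivity : 0 < n ^ 2 * (n - 1)),
    div_le_div_iff₀ (by positivity) h1]
  calc |t| * (n - 1) ≤ C * n ^ 2 * (n - 1) := mul_le_mul_of_nonneg_right h h1.le
    _ = _ := by ring

/-- Bound for the deviation on typical samples. -/
noncomputable def deviationBound (Q : ℕ) (c γ δ θ : ℝ) (n : ℕ) : ℝ :=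
  2 * (Q : ℝ) ^ 4 * -Real.log c * (4 * δ + 2 * (Q + 1) * θ) + -Real.log γ / n +
    (-Real.log c + -Real.log γ) / (n - 1)

lemma proportionSet_bounds {Q : ℕ} {γ : ℝ} (hγ : 0 < γ) {α : Fin Q → ℝ}
    (hα : α ∈ proportionSet Q γ) (q : Fin Q) : γ ≤ α q ∧ α q ≤ 1 :=
  ⟨(hα.1 q).1, by linarith [(hα.1 q).2]⟩

lemma proportionSet_le_one {Q : ℕ} {γ : ℝ} (hγ : 0 < γ) {α : Fin Q → ℝ}
    (hα : α ∈ proportionSet Q γ) : γ ≤ 1 := by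
  have h : ∃ _ : Fin Q, True := by
    by_contra! hcon
    have h1 : ∑ q, α q = 0 := Finset.sum_eq_zero fun q _ => (hcon q).elim
    exact zero_ne_one (h1.symm.trans hα.2)
  obtain ⟨q, -⟩ := h
  exact (proportionSet_bounds hγ hα q).1.trans (proportionSet_bounds hγ hα q).2

/-- A deterministic estimate on typical samples, whose bound involves neither `α` nor `π`; suprema
over both can be taken afterwards. -/
lemma absDiff_Mn_le {Q n : ℕ} {c γ δ θ : ℝ} (hc : 0 < c) (hc1 : c ≤ 1 / 2) (hγ0 : 0 < γ)
    {αs α : Fin Q → ℝ} (hαs : αs ∈ proportionSet Q γ) (hα : α ∈ proportionSet Q γ)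
    {πs π : Matrix (Fin Q) (Fin Q) ℝ} (hπs : πs ∈ gapSet Q c) (hπ : π ∈ gapSet Q c)
    (hθ : 0 < θ) (hδθ : 2 * δ ≤ c * θ ^ 2) (hγ : δ + Q * θ < γ)
    {z₀ : Fin n → Fin Q} {x : Fin n → Fin n → Bool} (hz₀ : TypicalLabels δ αs z₀)
    (hx : TypicalGraph δ πs z₀ x) (hn : 1 < n) (hnδ : 1 / (n : ℝ) ≤ δ) :
    absDiff (Mn x α π) (limitCriterion αs πs π) ≤
      ENNReal.ofReal (deviationBound Q c γ δ θ n) := by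
  have hn0 : 0 < n := by omega
  have hn' : (1 : ℝ) < n := by exact_mod_cast hn
  have hn0' : (0 : ℝ) < n := by linarith
  have hnpos : 0 < (n : ℝ) * ((n : ℝ) - 1) := mul_pos hn0' (by linarith)
  have hδ : 0 < δ := lt_of_lt_of_le (by positivity) hnδ
  have hπ' := entry_mem_Icc hc hπ
  have hαs' := proportionSet_bounds hγ0 hαs
  have hα' := proportionSet_bounds hγ0 hα
  have hγ1 := proportionSet_le_one hγ0 hα
  have hK : 0 ≤ -Real.log c := neg_nonneg.2 (Real.log_nonpos hc.le (by linarith))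
  have hG : 0 ≤ -Real.log γ := neg_nonneg.2 (Real.log_nonpos hγ0.le hγ1)
  set T := marginalLikelihood x α π with hT
  have hM : Mn x α π = elog T / (((n : ℝ) * ((n : ℝ) - 1) : ℝ) : EReal) := by
    rw [Mn, L2_eq x (fun q => hγ0.le.trans (hα' q).1) hπ']
  set K4 := 2 * (Q : ℝ) ^ 4 * -Real.log c with hK4
  have hK4' : 0 ≤ K4 := by positivity
  -- every positive likelihood is approximated by a value of the criterion
  have hupper : 0 < T → (∃ A ∈ Matrix.rowStochastic ℝ (Fin Q), Admissible c πs π A ∧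
      Real.log T / n ^ 2 ≤ realCriterion c αs πs π A + K4 * (4 * δ + 2 * (Q + 1) * θ)) ∧
      |Real.log T| ≤ (-Real.log c + -Real.log γ) * n ^ 2 := fun hTpos => by
    obtain ⟨z, hz⟩ := exists_marginalLikelihood_le x (fun q => hγ0.le.trans (hα' q).1) hα.2 hTpos
    have hzpos : 0 < likelihood x z π := hTpos.trans_le hz
    have hlog := Real.log_le_log hTpos hz
    rw [log_likelihood hc1 hπ hzpos.ne'] at hlog
    refine ⟨?_, ?_⟩
    · obtain ⟨A, hA, hadm, hle⟩ := exists_rowStochastic_approx hc hc1 hαs' hπs hπ hθ hδθ hγ hz₀ hx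
        hn0 hnδ hzpos.ne'
      refine ⟨A, hA, hadm, (div_le_div_of_nonneg_right hlog (by positivity)).trans ?_⟩
      have e : 2 * δ + 2 * (δ + ((Q : ℝ) + 1) * θ) = 4 * δ + 2 * (Q + 1) * θ := by ring
      rw [← hK4, e] at hle
      linarith [(abs_le.1 hle).2]
    · have h1 := abs_le.1 (abs_logLikelihood_le hc (by linarith) x z hπ')
      have h2 := (log_marginalLikelihood_ge hc1 x hγ0 (fun q => (hα' q).1) hπ hπ' hzpos).2
      have hT1 : Real.log T ≤ 0 := by
        refine Real.log_nonpos hTpos.le (hz.trans ?_)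
        refine Finset.prod_le_one (fun p _ => bernoulliMass_nonneg (hπ' _ _) _) fun p _ => ?_
        have := hπ' (z p.1) (z p.2)
        unfold bernoulliMass
        split_ifs <;> linarith
      rw [abs_of_nonpos hT1]
      have h3 : (n : ℝ) * -Real.log γ ≤ -Real.log γ * n ^ 2 := by nlinarith
      rw [← hT] at h2
      linarith
  rcases limitCriterion_cases hc hc1 (fun q => hγ0.trans_le (hαs' q).1) hπs hπ with
    ⟨hbot, hnone⟩ | ⟨A₀, hA₀, hadm₀, hval, hmax⟩
  -- A positive likelihood would produce an admissible matrix, so both sides are `⊥` together.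
  · have hT0 : T ≤ 0 := by
      by_contra hcon
      obtain ⟨⟨A, hA, hadm, -⟩, -⟩ := hupper (not_le.1 hcon)
      exact hnone A hA hadm
    have helog : elog T = ⊥ := by rw [elog, ENNReal.ofReal_of_nonpos hT0, ENNReal.log_zero]
    rw [hM, helog, hbot, EReal.bot_div_of_pos_ne_top (EReal.coe_pos.2 hnpos) (EReal.coe_ne_top _)]
    simp [absDiff]
  · obtain ⟨z, hz, hlow⟩ := exists_labelling_approx hc hc1
      (fun q => ⟨hγ0.le.trans (hαs' q).1, (hαs' q).2⟩) hπs hπ hz₀ hx hn0 hnδ hA₀ hadm₀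
    obtain ⟨hTpos, hge⟩ := log_marginalLikelihood_ge hc1 x hγ0 (fun q => (hα' q).1) hπ hπ' hz
    rw [← hT] at hTpos hge
    obtain ⟨⟨A, hA, hadm, hup⟩, habs⟩ := hupper hTpos
    rw [hM, elog_of_pos hTpos, ← EReal.coe_div, hval]
    refine absDiff_coe_le ?_
    have h1 := abs_div_mul_pred_sub_le hn' habs
    have h2 := hmax A hA hadm
    have h3 := div_le_div_of_nonneg_right hge (by positivity : (0 : ℝ) ≤ (n : ℝ) ^ 2)
    have h4 : (logLikelihood c x z π - n * -Real.log γ) / (n : ℝ) ^ 2 =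
        logLikelihood c x z π / n ^ 2 - -Real.log γ / n := by
      field_simp
    rw [h4] at h3
    have h5 : 0 ≤ -Real.log γ / n := by positivity
    have h6 : K4 * (4 * δ) ≤ K4 * (4 * δ + 2 * (Q + 1) * θ) :=
      mul_le_mul_of_nonneg_left (le_add_of_nonneg_right (by positivity)) hK4'
    rw [← hK4] at hlow
    -- Above: the matrix `A` built from the best labelling is no better than the maximiser `A₀`.
    -- Below: the labelling `z` built from `A₀` is one term of the likelihood.
    have h7 : |Real.log T / n ^ 2 - realCriterion c αs πs π A₀| ≤
        K4 * (4 * δ + 2 * (Q + 1) * θ) + -Real.log γ / n := by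
      rw [abs_le]; constructor <;> linarith
    refine (abs_sub_le _ (Real.log T / n ^ 2) _).trans ?_
    rw [deviationBound]
    linarith

open Filter in
lemma tendsto_deviationBound (Q : ℕ) (c γ δ θ : ℝ) :
    Tendsto (deviationBound Q c γ δ θ) atTop
      (𝓝 (2 * (Q : ℝ) ^ 4 * -Real.log c * (4 * δ + 2 * (Q + 1) * θ))) := by
  have h1 : Tendsto (fun n : ℕ => -Real.log γ / (n : ℝ)) atTop (𝓝 0) :=
    tendsto_const_div_atTop_nhds_zero_nat _
  have h2 : Tendsto (fun n : ℕ => (-Real.log c + -Real.log γ) / ((n : ℝ) - 1)) atTop (𝓝 0) :=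
    tendsto_const_nhds.div_atTop
      (tendsto_atTop_add_const_right _ _ tendsto_natCast_atTop_atTop)
  have := (tendsto_const_nhds (x := 2 * (Q : ℝ) ^ 4 * -Real.log c *
    (4 * δ + 2 * (Q + 1) * θ))).add h1 |>.add h2
  simp only [add_zero] at this
  exact this

lemma exists_cutoffs (Q : ℕ) {c γ ε K : ℝ} (hc : 0 < c) (hγ : 0 < γ) (hε : 0 < ε) (hK : 0 ≤ K) :
    ∃ δ θ : ℝ, 0 < δ ∧ δ ≤ 1 ∧ 0 < θ ∧ 2 * δ ≤ c * θ ^ 2 ∧ δ + Q * θ < γ ∧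
      K * (4 * δ + 2 * (Q + 1) * θ) < ε := by
  have hQ : (0 : ℝ) ≤ Q := Nat.cast_nonneg Q
  -- `θ` is fixed before `δ`, which has to be small compared with `c * θ ^ 2`.
  obtain ⟨θ, hθ, hθ'⟩ := exists_pos_mul_lt (show 0 < min (γ / 2) (ε / 2) by positivity)
    (Q + K * (2 * (Q + 1)))
  obtain ⟨δ, hδ, hδ'⟩ := exists_pos_mul_lt
    (show 0 < min (min (γ / 2) (ε / 2)) (min 1 (c * θ ^ 2)) by positivity) (2 + K * 4)
  have a1 := hθ'.trans_le (min_le_left _ _)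
  have a2 := hθ'.trans_le (min_le_right _ _)
  have b1 := (hδ'.trans_le (min_le_left _ _)).trans_le (min_le_left _ _)
  have b2 := (hδ'.trans_le (min_le_left _ _)).trans_le (min_le_right _ _)
  have b3 := (hδ'.trans_le (min_le_right _ _)).trans_le (min_le_left _ _)
  have b4 := (hδ'.trans_le (min_le_right _ _)).trans_le (min_le_right _ _)
  have p1 : 0 ≤ K * (2 * (Q + 1)) * θ := by positivity
  have p2 : 0 ≤ (Q : ℝ) * θ := by positivity
  have p3 : 0 ≤ K * 4 * δ := by positivity
  exact ⟨δ, θ, hδ, by linarith, hθ, by linarith, by linarith, by linarith⟩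

open Filter in
lemma IsSBM.tendsto_supDeviation {Ω : Type*} [MeasurableSpace Ω] {P : MeasureTheory.Measure Ω}
    {Q : ℕ} {γ ζ c : ℝ} (hc : 0 < c) (hc1 : c ≤ 1 / 2) (hcζ : c ≤ ζ) (hγ : 0 < γ)
    {αs : Fin Q → ℝ} (hαs : αs ∈ proportionSet Q γ)
    {πs : Matrix (Fin Q) (Fin Q) ℝ} (hπs : πs ∈ connectionSet Q ζ)
    {Z : ℕ → Ω → Fin Q} {X : ℕ → ℕ → Ω → Bool} (hX : IsSBM P αs πs Z X)
    {ε : ℝ≥0∞} (hε : 0 < ε) :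
    Tendsto (fun n : ℕ => P {ω | ε ≤ supDeviation γ ζ αs πs (adjacency X n ω)}) atTop (𝓝 0) := by
  -- `ε` may be infinite; a finite `r < ε` replaces it, and also turns the non-strict bound on the
  -- supremum into a strict one.
  obtain ⟨r, hr0, hr⟩ := ENNReal.lt_iff_exists_nnreal_btwn.1 hε
  have hr0' : (0 : ℝ) < r := by exact_mod_cast hr0
  have hK : 0 ≤ 2 * (Q : ℝ) ^ 4 * -Real.log c :=
    mul_nonneg (by positivity) (neg_nonneg.2 (Real.log_nonpos hc.le (by linarith)))
  obtain ⟨δ, θ, hδ, hδ1, hθ, hδθ, hδγ, hlt⟩ := exists_cutoffs Q hc hγ hr0' hK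
  have hg := connectionSet_subset_gapSet (Q := Q) hcζ
  have hα' := proportionSet_bounds hγ hαs
  have hmain := hX.tendsto_measure_not_typical (fun q => hγ.le.trans (hα' q).1) hαs.2
    (entry_mem_Icc hc (hg hπs)) hδ hδ1
  refine tendsto_of_tendsto_of_tendsto_of_le_of_le' tendsto_const_nhds hmain
    (Eventually.of_forall fun _ => zero_le) ?_
  filter_upwards [(tendsto_deviationBound Q c γ δ θ).eventually_lt_const hlt,
    (tendsto_const_div_atTop_nhds_zero_nat (1 : ℝ)).eventually_lt_const hδ,
    eventually_gt_atTop 1] with n hn1 hn2 hn3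
  refine MeasureTheory.measure_mono fun ω hω hgood => ?_
  refine absurd (le_trans (hω : ε ≤ _) ?_) (not_le.2 hr)
  refine iSup₂_le fun α hα => iSup₂_le fun π hπ => ?_
  refine (absDiff_Mn_le hc hc1 hγ hαs hα (hg hπs) (hg hπ) hθ hδθ hδγ hgood.1 hgood.2 hn3
    hn2.le).trans ?_
  rw [← ENNReal.ofReal_coe_nnreal]
  exact ENNReal.ofReal_le_ofReal hn1.le

end SBM

theorem theorem3p2 {Ω : Type*} [MeasurableSpace Ω] (P : MeasureTheory.Measure Ω)
    [MeasureTheory.IsProbabilityMeasure P]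
    (Q : ℕ) (γ ζ : ℝ) (hγ : 0 < γ) (hγQ : γ < 1 / (Q : ℝ)) (hζ : 0 < ζ)
    (αs : Fin Q → ℝ) (hαs : αs ∈ SBM.proportionSet Q γ)
    (πs : Matrix (Fin Q) (Fin Q) ℝ) (hπs : πs ∈ SBM.connectionSet Q ζ)
    (Z : ℕ → Ω → Fin Q) (X : ℕ → ℕ → Ω → Bool) (hX : SBM.IsSBM P αs πs Z X) :
    -- the maximum defining the limit criterion is attained
    (∀ π ∈ SBM.connectionSet Q ζ,
      ∃ A ∈ Matrix.rowStochastic ℝ (Fin Q),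
        SBM.limitCriterionAt αs πs π A = SBM.limitCriterion αs πs π) ∧
    -- the true matrix is a well separated maximum point
    (∀ d : Matrix (Fin Q) (Fin Q) ℝ → Matrix (Fin Q) (Fin Q) ℝ → ℝ,
      SBM.IsDistanceModRelabelling (SBM.connectionSet Q ζ) d →
      ∀ η : ℝ, 0 < η →
        (⨆ π ∈ {π ∈ SBM.connectionSet Q ζ | η ≤ d π πs}, SBM.limitCriterion αs πs π) <
          SBM.limitCriterion αs πs πs) ∧
    -- uniform convergence in probability
    (∀ ε : ℝ≥0∞, 0 < ε →
      Filter.Tendsto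
        (fun n : ℕ => P {ω | ε ≤ SBM.supDeviation γ ζ αs πs (SBM.adjacency X n ω)})
        Filter.atTop (𝓝 0)) := by
  -- The cap at `1 / 2` keeps `c` a valid truncation level even for `ζ > 1 / 2`, where all entries
  -- are `0` or `1`.
  have hc : 0 < min ζ (1 / 2) := lt_min hζ (by norm_num)
  have hc1 : min ζ (1 / 2) ≤ 1 / 2 := min_le_right _ _
  have hcζ : min ζ (1 / 2) ≤ ζ := min_le_left _ _
  have hα : ∀ q, 0 < αs q := fun q => hγ.trans_le (SBM.proportionSet_bounds hγ hαs q).1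
  have hg := SBM.connectionSet_subset_gapSet (Q := Q) hcζ
  exact ⟨fun π hπ => SBM.exists_limitCriterionAt_eq hc hc1 hα (hg hπs) (hg hπ),
    fun d hd η hη => SBM.iSup_limitCriterion_lt hc hc1 hcζ hα hπs hd hη,
    fun ε hε => hX.tendsto_supDeviation hc hc1 hcζ hγ hαs hπs hε⟩
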